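/- Circuits and verifiers. Quantum circuits are over the standard gate basis $\{H,\,K,\,K^{-1},\,\mathrm{CNOT},\,\mathrm{Toffoli}\}$ with $K=\mathrm{diag}(1,i)$. A verifier consists of polynomials $w,m$ and a family of circuits $(Q_x)_{x\in\{0,1\}^*}$, where $Q_x$ acts on $2w(n)+m(n)$ qubits, $n=|x|$, and a deterministic Turing machine computes a description of $Q_x$ from $x$ in time polynomial in $n$. For $w(n)$-qubit pure states $|\psi_1\rangle,|\psi_2\rangle$ put $\rho=|\psi_1\rangle\langle\psi_1|\otimes|\psi_2\rangle\langle\psi_2|\otimes|0\rangle\langle 0|^{\otimes m(n)}$. The bits $o$ and $p$ are the results of measuring the first and the second qubit of $Q_x\rho Q_x^\dagger$ in the computational basis, and $\Pr[o=1\mid p=1]=\Pr[o=1,p=1]/\Pr[p=1]$. For functions $c,s:\mathbb N\to[0,1]$, a language $L\subseteq\{0,1\}^*$ is in $\mathsf{QMA}(2)(c,s)$ if there is a verifier such that for every $n$ and every $x$ with $|x|=n$: if $x\in L$ then $\Pr[o=1]\ge c(n)$ for some $|\psi_1\rangle,|\psi_2\rangle$; if $x\notin L$ then $\Pr[o=1]\le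 s(n)$ for all $|\psi_1\rangle,|\psi_2\rangle$. $L$ is in $\mathsf{postQMA}(2)(c,s)$ if there are a verifier and a polynomial $l$ such that for every $n$ and every $x$ with $|x|=n$: $\Pr[p=1]\ge 2^{-l(n)}$ for all $|\psi_1\rangle,|\psi_2\rangle$; if $x\in L$ then $\Pr[o=1\mid p=1]\ge c(n)$ for some $|\psi_1\rangle,|\psi_2\rangle$; if $x\notin L$ then $\Pr[o=1\mid p=1]\le s(n)$ for all $|\psi_1\rangle,|\psi_2\rangle$. Lemma 2. There is a constant $s<1$ such that $$\mathsf{QMA}(2)(1,1-2^{-r})\subseteq\mathsf{postQMA}(2)(1,s)$$ holds for every polynomial $r$ with $r(n)\ge 0$ for all $n\in\mathbb N$. Moreover, $s$ can be taken arbitrarily close to $1/2$: for every $\delta>0$ there is such a constant, rational, with $0\le s<1$ and $s\le \tfrac12+\delta$, independent of $r$. -/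

import Mathlib

open scoped Matrix

noncomputable section

/-! ### Quantum circuits -/

/-- Computational basis strings of `N` qubits; `true` stands for `1`. -/
abbrev Bits (N : ℕ) : Type := Fin N → Bool

/-- Operators on the space of `N` qubits, as matrices in the computational basis. -/
abbrev QOp (N : ℕ) : Type := Matrix (Bits N) (Bits N) ℂ

/-- The gates of the standard basis `{H, K, K⁻¹, CNOT, Toffoli}`, `K = diag(1, i)`, placed on
pairwise distinct wires of a register of `N` qubits. -/
inductive Gate (N : ℕ) : Type
  | had (i : Fin N)
  | phase (i : Fin N)
  | phaseInv (i : Fin N)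
  | cnot (c t : Fin N) (h : c ≠ t)
  | toffoli (c d t : Fin N) (hcd : c ≠ d) (hct : c ≠ t) (hdt : d ≠ t)

/-- The Hadamard matrix. -/
def hadMatrix : Matrix Bool Bool ℂ :=
  fun y x => (if y && x then -1 else 1) / (Real.sqrt 2 : ℂ)

/-- The diagonal one-qubit matrix `diag(1, a)`. -/
def phaseMatrix (a : ℂ) : Matrix Bool Bool ℂ :=
  Matrix.diagonal fun x => if x then a else 1

/-- The one-qubit operator `U` acting on wire `i`, tensored with the identity elsewhere. -/
def onWire {N : ℕ} (U : Matrix Bool Bool ℂ) (i : Fin N) : QOp N :=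
  fun y x => if ∀ j, j ≠ i → y j = x j then U (y i) (x i) else 0

/-- The operator mapping every basis vector `|x⟩` to `|f x⟩`. -/
def basisMap {N : ℕ} (f : Bits N → Bits N) : QOp N :=
  fun y x => if y = f x then 1 else 0

/-- The unitary operator of a gate. -/
def Gate.op {N : ℕ} : Gate N → QOp N
  | .had i => onWire hadMatrix i
  | .phase i => onWire (phaseMatrix Complex.I) i
  | .phaseInv i => onWire (phaseMatrix (-Complex.I)) i
  | .cnot c t _ => basisMap fun x => Function.update x t (xor (x t) (x c))
  | .toffoli c d t _ _ _ => basisMap fun x => Function.update x t (xor (x t) (x c && x d))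

/-- A quantum circuit on `N` qubits: a list of gates, the head being applied first. -/
abbrev Circuit (N : ℕ) : Type := List (Gate N)

/-- The unitary operator of a circuit. -/
def Circuit.op {N : ℕ} : Circuit N → QOp N
  | [] => 1
  | g :: C => Circuit.op C * g.op

/-- The finite alphabet in which circuits are written down. -/
inductive GateSym : Type
  | had | phase | phaseInv | cnot | toffoli | tick | done

/-- The number of a wire, in unary, followed by an end mark. -/
def encodeWire {N : ℕ} (i : Fin N) : List GateSym :=
  List.replicate (i : ℕ) GateSym.tick ++ [GateSym.done]

/-- The description of a gate: its name and its wires. -/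
def Gate.encode {N : ℕ} : Gate N → List GateSym
  | .had i => GateSym.had :: encodeWire i
  | .phase i => GateSym.phase :: encodeWire i
  | .phaseInv i => GateSym.phaseInv :: encodeWire i
  | .cnot c t _ => GateSym.cnot :: (encodeWire c ++ encodeWire t)
  | .toffoli c d t _ _ _ =>
      GateSym.toffoli :: (encodeWire c ++ encodeWire d ++ encodeWire t)

/-- The description of a circuit: the descriptions of its gates, in order. -/
def Circuit.encode {N : ℕ} (C : Circuit N) : List GateSym :=
  C.flatMap Gate.encode

/-! ### States and measurements -/

/-- Pure states of `w` qubits: unit vectors. -/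
abbrev PureState (w : ℕ) : Type :=
  {ψ : EuclideanSpace ℂ (Bits w) // ‖ψ‖ = 1}

/-- The vector `|ψ₁⟩ ⊗ |ψ₂⟩ ⊗ |0⟩^{⊗ m}` of `2 w + m` qubits. -/
def inputVec {w : ℕ} (m : ℕ) (ψ₁ ψ₂ : PureState w) : Bits (2 * w + m) → ℂ := fun z =>
  ψ₁.1 (fun i => z ⟨i, by omega⟩) * ψ₂.1 (fun i => z ⟨w + i, by omega⟩) *
    (if ∀ j : Fin m, z ⟨2 * w + j, by omega⟩ = false then 1 else 0)

/-- The density matrix `|φ⟩⟨φ|`. -/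
def pureDensity {N : ℕ} (φ : Bits N → ℂ) : QOp N := Matrix.vecMulVec φ (star φ)

/-- The projector `|1⟩⟨1|` on wire `i`, tensored with the identity elsewhere. -/
def projOne {N : ℕ} (i : Fin N) : QOp N :=
  Matrix.diagonal fun z => if z i then 1 else 0

/-- The probability `Tr[P Q ρ Q†]` of the event `P` when the operator `Q` is applied to `ρ`. -/
def eventProb {N : ℕ} (P Q ρ : QOp N) : ℝ := (Matrix.trace (P * (Q * ρ * Qᴴ))).re

/-! ### Verifiers and complexity classes -/

/-- A polynomial-time uniform family of quantum circuits `Q_x`: the circuit for `x` acts on two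
proofs of `w(|x|)` qubits each and on `m(|x|)` ancilla qubits, and its description is computed
from `x` by a deterministic Turing machine in time polynomial in `|x|`. -/
structure Verifier where
  /-- number of qubits of each proof -/
  w : Polynomial ℕ
  /-- number of ancilla qubits -/
  m : Polynomial ℕ
  /-- the circuits -/
  circuit : ∀ x : List Bool, Circuit (2 * w.eval x.length + m.eval x.length)
  /-- uniformity -/
  uniform : Nonempty (Turing.TM2ComputableInPolyTime
    (fun x : List Bool => x) (fun y : List GateSym => y) (fun x => (circuit x).encode))

namespace Verifier

/-- The total number of qubits on inputs of length `n`. -/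
abbrev wires (V : Verifier) (n : ℕ) : ℕ := 2 * V.w.eval n + V.m.eval n

/-- The probability of the event `P` when the verifier runs on `x` with proofs `ψ₁`, `ψ₂`. -/
def prob (V : Verifier) (x : List Bool) (P : QOp (V.wires x.length))
    (ψ₁ ψ₂ : PureState (V.w.eval x.length)) : ℝ :=
  eventProb P (V.circuit x).op (pureDensity (inputVec (V.m.eval x.length) ψ₁ ψ₂))

/-- `Pr[o = 1]`, where the output `o` is the first qubit. -/
def probOut (V : Verifier) (h : ∀ n, 1 ≤ V.wires n) (x : List Bool)
    (ψ₁ ψ₂ : PureState (V.w.eval x.length)) : ℝ :=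
  V.prob x (projOne ⟨0, h x.length⟩) ψ₁ ψ₂

/-- `Pr[p = 1]`, where the postselection bit `p` is the second qubit. -/
def probPost (V : Verifier) (h : ∀ n, 2 ≤ V.wires n) (x : List Bool)
    (ψ₁ ψ₂ : PureState (V.w.eval x.length)) : ℝ :=
  V.prob x (projOne ⟨1, h x.length⟩) ψ₁ ψ₂

/-- `Pr[o = 1, p = 1]`, where `o` is the first and `p` the second qubit. -/
def probOutPost (V : Verifier) (h : ∀ n, 2 ≤ V.wires n) (x : List Bool)
    (ψ₁ ψ₂ : PureState (V.w.eval x.length)) : ℝ :=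
  V.prob x
    (projOne ⟨0, lt_of_lt_of_le Nat.zero_lt_two (h x.length)⟩ * projOne ⟨1, h x.length⟩) ψ₁ ψ₂

/-- `Pr[o = 1 | p = 1]`. -/
def probOutGivenPost (V : Verifier) (h : ∀ n, 2 ≤ V.wires n) (x : List Bool)
    (ψ₁ ψ₂ : PureState (V.w.eval x.length)) : ℝ :=
  V.probOutPost h x ψ₁ ψ₂ / V.probPost h x ψ₁ ψ₂

end Verifier

/-- The class `QMA(2)(c, s)`. -/
def QMA2 (c s : ℕ → ℝ) : Set (Language Bool) :=
  {L | ∃ (V : Verifier) (h : ∀ n, 1 ≤ V.wires n), ∀ x : List Bool,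
    (x ∈ L → ∃ ψ₁ ψ₂, c x.length ≤ V.probOut h x ψ₁ ψ₂) ∧
    (x ∉ L → ∀ ψ₁ ψ₂, V.probOut h x ψ₁ ψ₂ ≤ s x.length)}

/-- The class `postQMA(2)(c, s)`. -/
def postQMA2 (c s : ℕ → ℝ) : Set (Language Bool) :=
  {L | ∃ (V : Verifier) (h : ∀ n, 2 ≤ V.wires n) (l : Polynomial ℕ), ∀ x : List Bool,
    (∀ ψ₁ ψ₂, ((2 : ℝ) ^ l.eval x.length)⁻¹ ≤ V.probPost h x ψ₁ ψ₂) ∧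
    (x ∈ L → ∃ ψ₁ ψ₂, c x.length ≤ V.probOutGivenPost h x ψ₁ ψ₂) ∧
    (x ∉ L → ∀ ψ₁ ψ₂, V.probOutGivenPost h x ψ₁ ψ₂ ≤ s x.length)}

end

/-!
The inclusion holds with `s = 1 / 2`. Let a verifier accept with probability `a`, so that `a = 1`
is attained for `x ∈ L`, and `a ≤ 1 - 2⁻ʳ` always holds for `x ∉ L`. The new verifier runs the old
one and leaves the output `o` alone, but postselects so as to discard most of the accepting runs:
with a polynomial number `k ≥ r` of fair coins, `p = 1` if `o = 0` or if all coins show `1`. Then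
`Pr[o = 1, p = 1] = 2⁻ᵏ a` and `Pr[p = 1] = (1 - a) + 2⁻ᵏ a ≥ 2⁻ᵏ`, so that `Pr[o = 1 | p = 1]` is
`1` if `a = 1`, and at most `1 / 2` if `1 - a ≥ 2⁻ᵏ` (`eventProb_post`, `post_ratio_le_half`).

The coins are Hadamard gates on fresh wires, and their conjunction with `o` is computed by a chain
of Toffoli gates (`coinChain`, `postCircuit`). As every Hadamard gate of the chain meets a wire in
state `|0⟩`, the chain acts on the distribution of measured strings as a classical randomized
circuit, which `weight_had` and `coinChain_spec` express.

Uniformity needs a Turing machine that writes down the new circuit (`polyTime_append_postCode`).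
The number of coins has the form `k = c (n + 1) ^ j`, chosen also to exceed the number of wires of
the old circuit; then the fresh wires can start at wire `k`, and the description of the added gates
depends on `k` alone. The machine is put together from loops over stacks (`StackProg`), for which
running times are additive. It records the input length, runs the old machine, computes `k` in
unary by repeated multiplication, and appends the gates. The time to copy the output of the old
machine is polynomial because stacks grow at most linearly in the running time
(`RunsTo.length_le`).
-/

noncomputable section

/-! ### Weights of events -/

/-- The weight `∑ |ψ z|²` of a (not necessarily normalized) vector `ψ` on the set `E` of basis
strings: the probability of `E` when the state `ψ` is measured in the computational basis. -/
def weight {N : ℕ} (ψ : Bits N → ℂ) (E : Bits N → Prop) [DecidablePred E] : ℝ :=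
  ∑ z, if E z then ‖ψ z‖ ^ 2 else 0

section Weight

variable {N : ℕ}

/-- Events that agree on the support of `ψ` have the same weight. -/
lemma weight_congr {ψ : Bits N → ℂ} {E F : Bits N → Prop} [DecidablePred E] [DecidablePred F]
    (h : ∀ z, ψ z ≠ 0 → (E z ↔ F z)) : weight ψ E = weight ψ F := by
  refine Finset.sum_congr rfl fun z _ => ?_
  by_cases hz : ψ z = 0
  · simp [hz]
  · simp [h z hz]

lemma weight_nonneg (ψ : Bits N → ℂ) (E : Bits N → Prop) [DecidablePred E] : 0 ≤ weight ψ E :=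
  Finset.sum_nonneg fun z _ => by split_ifs <;> positivity

lemma weight_or_of_disjoint {ψ : Bits N → ℂ} {E F : Bits N → Prop} [DecidablePred E]
    [DecidablePred F] (h : ∀ z, ψ z ≠ 0 → ¬ (E z ∧ F z)) :
    weight ψ (fun z => E z ∨ F z) = weight ψ E + weight ψ F := by
  simp only [weight, ← Finset.sum_add_distrib]
  refine Finset.sum_congr rfl fun z _ => ?_
  by_cases hz : ψ z = 0
  · simp [hz]
  · have := h z hz
    by_cases hE : E z <;> by_cases hF : F z <;> simp_all

lemma vecMulVec_conj (Q : QOp N) (φ : Bits N → ℂ) :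
    Q * pureDensity φ * Qᴴ = pureDensity (Q *ᵥ φ) := by
  rw [pureDensity, pureDensity, Matrix.mul_vecMulVec, Matrix.vecMulVec_mul, Matrix.star_mulVec]

/-- The probability of an event of the computational basis is its weight in the output vector. -/
lemma eventProb_diagonal (Q : QOp N) (φ : Bits N → ℂ) (E : Bits N → Prop) [DecidablePred E] :
    eventProb (Matrix.diagonal fun z => if E z then 1 else 0) Q (pureDensity φ)
      = weight (Q *ᵥ φ) E := by
  rw [eventProb, vecMulVec_conj, pureDensity, Matrix.trace, Complex.re_sum, weight]
  refine Finset.sum_congr rfl fun z _ => ?_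
  rw [Matrix.diag_apply, Matrix.diagonal_mul, Matrix.vecMulVec_apply]
  split_ifs
  · rw [one_mul, Pi.star_apply, Complex.star_def, Complex.mul_conj, Complex.normSq_eq_norm_sq,
      Complex.ofReal_re]
  · simp

lemma sum_update_false_add_update_true (i : Fin N) (F : Bits N → ℝ) :
    ∑ z, (F (Function.update z i false) + F (Function.update z i true)) = 2 * ∑ z, F z := by
  have hflip : ∑ z : Bits N, F (Function.update z i (!z i)) = ∑ z, F z := by
    refine Fintype.sum_bijective (fun z : Bits N => Function.update z i (!z i))
      (Function.Involutive.bijective fun z => ?_) _ _ fun z => rfl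
    simp
  rw [two_mul]
  nth_rewrite 2 [← hflip]
  rw [← Finset.sum_add_distrib]
  refine Finset.sum_congr rfl fun z _ => ?_
  conv_rhs => rw [← Function.update_eq_self i z]
  cases h : z i
  · simp
  · simp [add_comm]

end Weight

/-! ### Action of the gates -/

section Action

variable {N : ℕ}

lemma onWire_mulVec (U : Matrix Bool Bool ℂ) (i : Fin N) (ψ : Bits N → ℂ) (z : Bits N) :
    (onWire U i *ᵥ ψ) z = U (z i) false * ψ (Function.update z i false)
      + U (z i) true * ψ (Function.update z i true) := by
  have hne : Function.update z i false ≠ Function.update z i true := fun h => by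
    simpa using congrFun h i
  rw [Matrix.mulVec, dotProduct]
  rw [← Finset.sum_subset (Finset.subset_univ
    {Function.update z i false, Function.update z i true}), Finset.sum_pair hne]
  · have h : ∀ b, ∀ j, j ≠ i → z j = Function.update z i b j := fun b j hj => by simp [hj]
    simp only [onWire, if_pos (h _), Function.update_self]
  · intro x _ hx
    have : ¬ ∀ j, j ≠ i → z j = x j := by
      intro h
      have hxz : x = Function.update z i (x i) := by
        funext j
        by_cases hj : j = i
        · subst hj; simp
        · simp [hj, h j hj]
      cases hb : x i <;> rw [hb] at hxz <;> simp [← hxz] at hx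
    simp only [onWire, if_neg this, zero_mul]

lemma basisMap_mulVec {f : Bits N → Bits N} (hf : Function.Involutive f) (ψ : Bits N → ℂ)
    (z : Bits N) : (basisMap f *ᵥ ψ) z = ψ (f z) := by
  rw [Matrix.mulVec, dotProduct, Finset.sum_eq_single (f z)]
  · simp [basisMap, hf z]
  · intro x _ hx
    have : z ≠ f x := fun h => hx (by rw [h, hf x])
    simp [basisMap, this]
  · simp

lemma weight_basisMap {f : Bits N → Bits N} (hf : Function.Involutive f) (ψ : Bits N → ℂ)
    (E : Bits N → Prop) [DecidablePred E] :
    weight (basisMap f *ᵥ ψ) E = weight ψ (fun z => E (f z)) := by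
  simp only [weight, basisMap_mulVec hf]
  exact Fintype.sum_bijective f hf.bijective _ _ fun z => by simp only [hf z]

/-- The permutation of the basis strings performed by a CNOT gate. -/
def cnotMap (c t : Fin N) (x : Bits N) : Bits N := Function.update x t (xor (x t) (x c))

/-- The permutation of the basis strings performed by a Toffoli gate. -/
def toffoliMap (c d t : Fin N) (x : Bits N) : Bits N :=
  Function.update x t (xor (x t) (x c && x d))

lemma cnotMap_involutive {c t : Fin N} (h : c ≠ t) : Function.Involutive (cnotMap c t) := by
  intro x
  simp [cnotMap, h]

lemma toffoliMap_involutive {c d t : Fin N} (h : c ≠ t) (h' : d ≠ t) :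
    Function.Involutive (toffoliMap c d t) := by
  intro x
  simp [toffoliMap, h, h']

lemma weight_cnot {c t : Fin N} (h : c ≠ t) (ψ : Bits N → ℂ) (E : Bits N → Prop)
    [DecidablePred E] :
    weight ((Gate.cnot c t h).op *ᵥ ψ) E = weight ψ (fun z => E (cnotMap c t z)) :=
  weight_basisMap (cnotMap_involutive h) ψ E

lemma cnot_mulVec {c t : Fin N} (h : c ≠ t) (ψ : Bits N → ℂ) (z : Bits N) :
    ((Gate.cnot c t h).op *ᵥ ψ) z = ψ (cnotMap c t z) :=
  basisMap_mulVec (cnotMap_involutive h) ψ z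

lemma weight_toffoli {c d t : Fin N} (h : c ≠ d) (h' : c ≠ t) (h'' : d ≠ t) (ψ : Bits N → ℂ)
    (E : Bits N → Prop) [DecidablePred E] :
    weight ((Gate.toffoli c d t h h' h'').op *ᵥ ψ) E
      = weight ψ (fun z => E (toffoliMap c d t z)) :=
  weight_basisMap (toffoliMap_involutive h' h'') ψ E

lemma toffoli_mulVec {c d t : Fin N} (h : c ≠ d) (h' : c ≠ t) (h'' : d ≠ t) (ψ : Bits N → ℂ)
    (z : Bits N) :
    ((Gate.toffoli c d t h h' h'').op *ᵥ ψ) z = ψ (toffoliMap c d t z) :=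
  basisMap_mulVec (toffoliMap_involutive h' h'') ψ z

lemma ofReal_sqrt_two_sq : (Real.sqrt 2 : ℂ) ^ 2 = 2 := by
  rw [← Complex.ofReal_pow, Real.sq_sqrt (by norm_num)]; norm_num

/-- A Hadamard gate on a wire in state `|0⟩`. -/
lemma had_mulVec {i : Fin N} {ψ : Bits N → ℂ} (hψ : ∀ z, ψ z ≠ 0 → z i = false) (z : Bits N) :
    ((Gate.had i).op *ᵥ ψ) z = ψ (Function.update z i false) / (Real.sqrt 2 : ℂ) := by
  have h1 : ψ (Function.update z i true) = 0 := by
    by_contra h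
    simpa using hψ _ h
  rw [Gate.op, onWire_mulVec, h1]
  simp [hadMatrix]
  ring

/-- A Hadamard gate on a wire in state `|0⟩` replaces that bit by a fair coin. -/
lemma weight_had {i : Fin N} {ψ : Bits N → ℂ} (hψ : ∀ z, ψ z ≠ 0 → z i = false)
    (E : Bits N → Prop) [DecidablePred E] :
    weight ((Gate.had i).op *ᵥ ψ) E
      = (weight ψ (fun z => E (Function.update z i false))
        + weight ψ (fun z => E (Function.update z i true))) / 2 := by
  -- Both sides are averages over bit `i`; only strings in which that bit is `0` carry weight.
  have key : ∀ b, weight ψ (fun z => E (Function.update z i b))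
      = ∑ z, (if E (Function.update z i b) then ‖ψ (Function.update z i false)‖ ^ 2 else 0) / 2
        + ∑ z, (if E (Function.update z i b) then ‖ψ (Function.update z i true)‖ ^ 2 else 0) / 2 := by
    intro b
    have := sum_update_false_add_update_true i
      (fun z => if E (Function.update z i b) then ‖ψ z‖ ^ 2 else 0)
    simp only [Function.update_idem] at this
    rw [weight, ← Finset.sum_add_distrib]
    simp only [← add_div]
    rw [← Finset.sum_div, this]
    ring
  have h1 : ∀ z, ψ (Function.update z i true) = 0 := fun z => by
    by_contra h
    simpa using hψ _ h
  rw [key, key]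
  simp only [h1, norm_zero]
  have := sum_update_false_add_update_true i
    (fun z => if E z then ‖ψ (Function.update z i false)‖ ^ 2 / 2 else 0)
  simp only [Function.update_idem] at this
  have h2 : weight ((Gate.had i).op *ᵥ ψ) E
      = ∑ z, if E z then ‖ψ (Function.update z i false)‖ ^ 2 / 2 else 0 := by
    refine Finset.sum_congr rfl fun z _ => ?_
    rw [had_mulVec hψ, norm_div, div_pow]
    simp
  rw [h2, eq_div_iff two_ne_zero, mul_comm, ← this, Finset.sum_add_distrib]
  simp [ite_div]

lemma norm_sq_hadMatrix (a b : ℂ) :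
    ‖hadMatrix false false * a + hadMatrix false true * b‖ ^ 2
      + ‖hadMatrix true false * a + hadMatrix true true * b‖ ^ 2 = ‖a‖ ^ 2 + ‖b‖ ^ 2 := by
  have h1 : hadMatrix false false * a + hadMatrix false true * b = (a + b) / (Real.sqrt 2 : ℂ) := by
    simp [hadMatrix]; ring
  have h2 : hadMatrix true false * a + hadMatrix true true * b = (a - b) / (Real.sqrt 2 : ℂ) := by
    simp [hadMatrix]; ring
  rw [h1, h2, norm_div, norm_div, div_pow, div_pow]
  have := parallelogram_law_with_norm ℝ a b
  simp
  nlinarith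

lemma norm_sq_phaseMatrix {u : ℂ} (hu : ‖u‖ = 1) (a b : ℂ) :
    ‖phaseMatrix u false false * a + phaseMatrix u false true * b‖ ^ 2
      + ‖phaseMatrix u true false * a + phaseMatrix u true true * b‖ ^ 2 = ‖a‖ ^ 2 + ‖b‖ ^ 2 := by
  simp [phaseMatrix, hu]

lemma weight_onWire_true {U : Matrix Bool Bool ℂ} (i : Fin N)
    (hU : ∀ a b, ‖U false false * a + U false true * b‖ ^ 2
      + ‖U true false * a + U true true * b‖ ^ 2 = ‖a‖ ^ 2 + ‖b‖ ^ 2) (ψ : Bits N → ℂ) :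
    weight (onWire U i *ᵥ ψ) (fun _ => True) = weight ψ (fun _ => True) := by
  have h1 := sum_update_false_add_update_true i (fun z => ‖(onWire U i *ᵥ ψ) z‖ ^ 2)
  have h2 := sum_update_false_add_update_true i (fun z => ‖ψ z‖ ^ 2)
  simp only [onWire_mulVec, Function.update_idem, Function.update_self, hU] at h1
  simp only [weight, if_true, onWire_mulVec]
  linarith

/-- Circuits preserve the norm. -/
lemma Circuit.weight_true (C : Circuit N) (ψ : Bits N → ℂ) :
    weight (C.op *ᵥ ψ) (fun _ => True) = weight ψ (fun _ => True) := by
  induction C generalizing ψ with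
  | nil => simp [Circuit.op]
  | cons g C ih =>
    rw [Circuit.op, ← Matrix.mulVec_mulVec, ih]
    cases g with
    | had i => exact weight_onWire_true i norm_sq_hadMatrix ψ
    | phase i => exact weight_onWire_true i (norm_sq_phaseMatrix (by simp)) ψ
    | phaseInv i => exact weight_onWire_true i (norm_sq_phaseMatrix (by simp)) ψ
    | cnot c t h => exact weight_cnot h ψ _
    | toffoli c d t h h' h'' => exact weight_toffoli h h' h'' ψ _

lemma Circuit.op_append (C D : Circuit N) : Circuit.op (C ++ D) = D.op * C.op := by
  induction C with
  | nil => simp [Circuit.op]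
  | cons g C ih => simp [Circuit.op, ih, Matrix.mul_assoc]

/-- The NOT gate as `H K K H`. -/
def notCircuit (i : Fin N) : Circuit N := [.had i, .phase i, .phase i, .had i]

lemma notCircuit_mulVec (i : Fin N) (ψ : Bits N → ℂ) (z : Bits N) :
    ((notCircuit i).op *ᵥ ψ) z = ψ (Function.update z i (!z i)) := by
  have hI : Complex.I ^ 2 = -1 := Complex.I_sq
  have hs := ofReal_sqrt_two_sq
  have h0 : (Real.sqrt 2 : ℂ) ≠ 0 := by simp
  simp only [notCircuit, Circuit.op, Gate.op, Matrix.one_mul, ← Matrix.mulVec_mulVec]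
  have hmain : ∀ b, z i = b → (onWire hadMatrix i *ᵥ (onWire (phaseMatrix Complex.I) i *ᵥ
      (onWire (phaseMatrix Complex.I) i *ᵥ (onWire hadMatrix i *ᵥ ψ)))) z
        = ψ (Function.update z i (!b)) := by
    intro b hz
    simp only [onWire_mulVec, Function.update_idem, Function.update_self, hz]
    cases b <;> simp [hadMatrix, phaseMatrix] <;> field_simp <;> rw [hs]
    · linear_combination (ψ (Function.update z i false) - ψ (Function.update z i true)) * hI
    · linear_combination (ψ (Function.update z i true) - ψ (Function.update z i false)) * hI
  exact hmain _ rfl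

lemma weight_notCircuit (i : Fin N) (ψ : Bits N → ℂ) (E : Bits N → Prop) [DecidablePred E] :
    weight ((notCircuit i).op *ᵥ ψ) E = weight ψ (fun z => E (Function.update z i (!z i))) := by
  simp only [weight, notCircuit_mulVec]
  have hinv : Function.Involutive fun z : Bits N => Function.update z i (!z i) := fun z => by simp
  exact Fintype.sum_bijective _ hinv.bijective _ _ fun z => by simp

end Action

/-! ### Adding idle wires -/

section Lift

variable {N N' : ℕ}

/-- The gate placed on the first `N` wires of a larger register. -/
def Gate.lift (h : N ≤ N') : Gate N → Gate N'
  | .had i => .had (i.castLE h)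
  | .phase i => .phase (i.castLE h)
  | .phaseInv i => .phaseInv (i.castLE h)
  | .cnot c t hct => .cnot (c.castLE h) (t.castLE h) ((Fin.castLE_injective h).ne hct)
  | .toffoli c d t hcd hct hdt => .toffoli (c.castLE h) (d.castLE h) (t.castLE h)
      ((Fin.castLE_injective h).ne hcd) ((Fin.castLE_injective h).ne hct)
      ((Fin.castLE_injective h).ne hdt)

/-- The circuit placed on the first `N` wires of a larger register. -/
def Circuit.lift (h : N ≤ N') (C : Circuit N) : Circuit N' := C.map (Gate.lift h)

lemma Gate.encode_lift (h : N ≤ N') (g : Gate N) : (g.lift h).encode = g.encode := by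
  cases g <;> rfl

lemma Circuit.encode_lift (h : N ≤ N') (C : Circuit N) :
    Circuit.encode (C.lift h) = Circuit.encode C := by
  simp only [Circuit.encode, Circuit.lift, List.flatMap_map, Gate.encode_lift]

lemma Circuit.encode_append (C D : Circuit N) :
    Circuit.encode (C ++ D) = Circuit.encode C ++ Circuit.encode D :=
  List.flatMap_append

/-- The vector `φ ⊗ |0 ⋯ 0⟩` of a larger register. -/
def padZero (h : N ≤ N') (φ : Bits N → ℂ) (z : Bits N') : ℂ :=
  if ∀ j : Fin N', N ≤ j → z j = false then φ (fun i => z (i.castLE h)) else 0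

lemma padZero_ne_zero {h : N ≤ N'} {φ : Bits N → ℂ} {z : Bits N'} (hz : padZero h φ z ≠ 0)
    {j : Fin N'} (hj : N ≤ j) : z j = false := by
  rw [padZero] at hz
  split_ifs at hz with hz'
  · exact hz' j hj
  · exact absurd rfl hz

lemma update_castLE_comp (h : N ≤ N') (z : Bits N') (i : Fin N) (b : Bool) :
    (fun j : Fin N => Function.update z (i.castLE h) b (j.castLE h))
      = Function.update (fun j => z (j.castLE h)) i b := by
  funext j
  by_cases hj : j = i
  · subst hj; simp
  · simp [hj]

lemma padZero_update (h : N ≤ N') (φ : Bits N → ℂ) (z : Bits N') (i : Fin N) (b : Bool) :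
    padZero h φ (Function.update z (i.castLE h) b)
      = if ∀ j : Fin N', N ≤ j → z j = false
          then φ (Function.update (fun j => z (j.castLE h)) i b) else 0 := by
  have : (∀ j : Fin N', N ≤ j → Function.update z (i.castLE h) b j = false)
      ↔ ∀ j : Fin N', N ≤ j → z j = false := by
    refine forall_congr' fun j => imp_congr_right fun hj => ?_
    have : j ≠ i.castLE h := by
      rintro rfl
      exact absurd i.2 (not_lt.2 hj)
    simp [this]
  simp only [padZero, this, update_castLE_comp]

lemma onWire_padZero (h : N ≤ N') (U : Matrix Bool Bool ℂ) (i : Fin N) (φ : Bits N → ℂ) :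
    onWire U (i.castLE h) *ᵥ padZero h φ = padZero h (onWire U i *ᵥ φ) := by
  funext z
  rw [onWire_mulVec, padZero_update, padZero_update, padZero, onWire_mulVec]
  split_ifs <;> simp

lemma Gate.lift_mulVec (h : N ≤ N') (g : Gate N) (φ : Bits N → ℂ) :
    (g.lift h).op *ᵥ padZero h φ = padZero h (g.op *ᵥ φ) := by
  cases g with
  | had i => exact onWire_padZero h _ i φ
  | phase i => exact onWire_padZero h _ i φ
  | phaseInv i => exact onWire_padZero h _ i φ
  | cnot c t hct =>
    funext z
    rw [Gate.lift, cnot_mulVec, cnotMap, padZero_update, padZero, cnot_mulVec, cnotMap]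
  | toffoli c d t hcd hct hdt =>
    funext z
    rw [Gate.lift, toffoli_mulVec, toffoliMap, padZero_update, padZero, toffoli_mulVec,
      toffoliMap]

lemma Circuit.lift_mulVec (h : N ≤ N') (C : Circuit N) (φ : Bits N → ℂ) :
    (Circuit.lift h C).op *ᵥ padZero h φ = padZero h (Circuit.op C *ᵥ φ) := by
  induction C generalizing φ with
  | nil => simp [Circuit.op, Circuit.lift]
  | cons g C ih =>
    rw [Circuit.lift, List.map_cons, ← Circuit.lift, Circuit.op, Circuit.op,
      ← Matrix.mulVec_mulVec, ← Matrix.mulVec_mulVec, Gate.lift_mulVec, ih]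

lemma weight_padZero (h : N ≤ N') (φ : Bits N → ℂ) (E : Bits N → Prop) [DecidablePred E] :
    weight (padZero h φ) (fun z => E fun i => z (i.castLE h)) = weight φ E := by
  symm
  let e : Bits N → Bits N' := fun y j => if hj : (j : ℕ) < N then y ⟨j, hj⟩ else false
  have he : ∀ y, (fun i : Fin N => e y (i.castLE h)) = y := fun y => by
    funext i; simp [e]
  refine Fintype.sum_of_injective e (fun y y' hy => ?_) _ _ (fun z hz => ?_) fun y => ?_
  · rw [← he y, ← he y', hy]
  · have : padZero h φ z = 0 := by
      by_contra hne
      refine hz ⟨fun i => z (i.castLE h), ?_⟩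
      funext j
      by_cases hj : (j : ℕ) < N
      · simp [e, hj]
      · simpa [e, hj] using (padZero_ne_zero hne (not_lt.1 hj)).symm
    simp [this]
  · have : padZero h φ (e y) = φ y := by
      rw [padZero, if_pos, he]
      intro j hj
      simp [e, not_lt.2 hj]
    simp only [this, he]

lemma inputVec_eq_padZero {w m m' : ℕ} (h : 2 * w + m ≤ 2 * w + m') (ψ₁ ψ₂ : PureState w) :
    inputVec m' ψ₁ ψ₂ = padZero h (inputVec m ψ₁ ψ₂) := by
  funext z
  by_cases hz : ∀ j : Fin m', z ⟨2 * w + j, by omega⟩ = false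
  · have h1 : ∀ j : Fin (2 * w + m'), 2 * w + m ≤ j → z j = false := fun j hj => by
      have := hz ⟨j - 2 * w, by omega⟩
      convert this using 2
      ext; simp; omega
    have h2 : ∀ j : Fin m, z (Fin.castLE h ⟨2 * w + j, by omega⟩) = false := fun j =>
      hz ⟨j, by omega⟩
    rw [padZero, if_pos h1, inputVec, inputVec, if_pos hz, if_pos h2]
    rfl
  · rw [inputVec, if_neg hz, padZero]
    split_ifs with h1
    · rw [inputVec, if_neg, mul_zero, mul_zero]
      intro h2
      refine hz fun j => ?_
      by_cases hj : (j : ℕ) < m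
      · exact h2 ⟨j, hj⟩
      · exact h1 _ (by simp; omega)
    · simp

/-- The input vector is a unit vector. -/
lemma weight_inputVec {w : ℕ} (m : ℕ) (ψ₁ ψ₂ : PureState w) :
    weight (inputVec m ψ₁ ψ₂) (fun _ => True) = 1 := by
  have hn : ∀ ψ : PureState w, ∑ z, ‖ψ.1 z‖ ^ 2 = 1 := fun ψ => by
    rw [← EuclideanSpace.norm_sq_eq, ψ.2, one_pow]
  have h0 : weight (inputVec 0 ψ₁ ψ₂) (fun _ => True) = 1 := by
    let e : Bits w × Bits w → Bits (2 * w + 0) := fun y j =>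
      if hj : (j : ℕ) < w then y.1 ⟨j, hj⟩ else y.2 ⟨j - w, by omega⟩
    have he1 : ∀ y, (fun i : Fin w => e y ⟨i, by omega⟩) = y.1 := fun y => by
      funext i; simp [e]
    have he2 : ∀ y, (fun i : Fin w => e y ⟨w + i, by omega⟩) = y.2 := fun y => by
      funext i; simp [e]
    have hprod : ∑ y : Bits w × Bits w, ‖ψ₁.1 y.1‖ ^ 2 * ‖ψ₂.1 y.2‖ ^ 2 = 1 := by
      rw [Fintype.sum_prod_type]
      simp only [← Finset.sum_mul_sum, hn, one_mul]
    rw [← hprod]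
    symm
    refine Fintype.sum_of_injective e (fun y y' hy => ?_) _ _ (fun z hz => ?_) fun y => ?_
    · exact Prod.ext (by rw [← he1 y, ← he1 y', hy]) (by rw [← he2 y, ← he2 y', hy])
    · refine (hz ⟨(fun i => z ⟨i, by omega⟩, fun i => z ⟨w + i, by omega⟩), ?_⟩).elim
      funext j
      by_cases hj : (j : ℕ) < w
      · simp [e, hj]
      · simp only [e, hj, dite_false]
        congr 1
        ext; simp; omega
    · simp only [inputVec, he1, he2]
      simp [mul_pow]
  have h : 2 * w + 0 ≤ 2 * w + m := by omega
  rw [inputVec_eq_padZero h]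
  exact (weight_padZero h _ fun _ => True).trans h0

end Lift

/-! ### The postselection circuit -/

section Chain

variable {N : ℕ}

/-- A chain of `k` coin tosses. Round `j` tosses a coin on wire `b + 2 j + 1` and writes the
conjunction of the coin and of wire `b + 2 j` on wire `b + 2 j + 2`. -/
def coinChain : (b k : ℕ) → b + 2 * k < N → Circuit N
  | _, 0, _ => []
  | b, k + 1, h =>
    .had ⟨b + 1, by omega⟩ ::
    .toffoli ⟨b, by omega⟩ ⟨b + 1, by omega⟩ ⟨b + 2, by omega⟩ (by simp) (by simp) (by simp) ::
    coinChain (b + 2) k (by omega)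

/-- The coin chain started on a wire `b` that is only set if the output wire `0` is. The last wire
of the chain is set with `2⁻ᵏ` times the weight with which wire `b` was; it still implies the
output, whose distribution does not change. -/
lemma coinChain_spec {b k : ℕ} (h : b + 2 * k < N) (hb : 0 < b) {ψ : Bits N → ℂ}
    (hzero : ∀ z, ψ z ≠ 0 → ∀ j : Fin N, b < j → z j = false)
    (himp : ∀ z, ψ z ≠ 0 → z ⟨b, by omega⟩ = true → z ⟨0, by omega⟩ = true) :
    (∀ z, ((coinChain b k h).op *ᵥ ψ) z ≠ 0 → z ⟨b + 2 * k, h⟩ = true → z ⟨0, by omega⟩ = true) ∧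
    weight ((coinChain b k h).op *ᵥ ψ) (fun z => z ⟨b + 2 * k, h⟩ = true)
      = (2 ^ k)⁻¹ * weight ψ (fun z => z ⟨b, by omega⟩ = true) ∧
    weight ((coinChain b k h).op *ᵥ ψ) (fun z => z ⟨0, by omega⟩ = false)
      = weight ψ (fun z => z ⟨0, by omega⟩ = false) := by
  induction k generalizing b ψ with
  | zero => simpa [coinChain, Circuit.op] using himp
  | succ k ih =>
    have hcoin : ∀ z, ψ z ≠ 0 → z ⟨b + 1, by omega⟩ = false := fun z hz =>
      hzero z hz _ (Nat.lt_succ_self b)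
    set χ := (Gate.had ⟨b + 1, by omega⟩).op *ᵥ ψ with hχ
    set ψ' := (Gate.toffoli ⟨b, by omega⟩ ⟨b + 1, by omega⟩ ⟨b + 2, by omega⟩
      (by simp) (by simp) (by simp) : Gate N).op *ᵥ χ with hψ'
    have hsupp : ∀ z, ψ' z ≠ 0 → ∃ y, ψ y ≠ 0 ∧ (∀ j : Fin N, j.1 ≠ b + 1 → j.1 ≠ b + 2 →
        z j = y j) ∧ z ⟨b + 2, by omega⟩ = (y ⟨b, by omega⟩ && z ⟨b + 1, by omega⟩) := by
      intro z hz
      rw [hψ', toffoli_mulVec, hχ, had_mulVec hcoin] at hz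
      refine ⟨_, fun h0 => hz (by rw [h0, zero_div]), fun j h1 h2 => ?_, ?_⟩
      · simp [toffoliMap, Fin.ext_iff, h1, h2]
      · have h3 := hzero _ (fun h0 => hz (by rw [h0, zero_div])) ⟨b + 2, by omega⟩ (by simp)
        simp [toffoliMap, Fin.ext_iff] at h3 ⊢
        exact h3
    obtain ⟨h1, h2, h3⟩ := ih (b := b + 2) (ψ := ψ') (by omega) (by omega)
      (fun z hz j hj => by
        obtain ⟨y, hy, hzy, -⟩ := hsupp z hz
        rw [hzy j (by omega) (by omega)]
        exact hzero y hy j (by omega))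
      (fun z hz hzb => by
        obtain ⟨y, hy, hzy, hzb'⟩ := hsupp z hz
        rw [hzb', Bool.and_eq_true] at hzb
        rw [hzy _ (by simp) (by simp)]
        exact himp y hy hzb.1)
    have hop : (coinChain b (k + 1) h).op *ᵥ ψ = (coinChain (b + 2) k (by omega)).op *ᵥ ψ' := by
      simp only [coinChain, Circuit.op, ← Matrix.mulVec_mulVec, hψ', hχ]
    have hidx : (⟨b + 2 * (k + 1), h⟩ : Fin N) = ⟨b + 2 + 2 * k, by omega⟩ := by
      ext; simp; omega
    rw [hop, hidx]
    refine ⟨h1, ?_, ?_⟩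
    · have e1 : weight ψ (fun z => toffoliMap ⟨b, by omega⟩ ⟨b + 1, by omega⟩ ⟨b + 2, by omega⟩
          (Function.update z ⟨b + 1, by omega⟩ false) ⟨b + 2, by omega⟩ = true) = 0 := by
        refine Finset.sum_eq_zero fun z _ => ?_
        by_cases hz : ψ z = 0
        · simp [hz]
        · have := hzero z hz ⟨b + 2, by omega⟩ (by simp)
          simp [toffoliMap, Fin.ext_iff, this]
      have e2 : weight ψ (fun z => toffoliMap ⟨b, by omega⟩ ⟨b + 1, by omega⟩ ⟨b + 2, by omega⟩
          (Function.update z ⟨b + 1, by omega⟩ true) ⟨b + 2, by omega⟩ = true)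
          = weight ψ (fun z => z ⟨b, by omega⟩ = true) := by
        refine weight_congr fun z hz => ?_
        have := hzero z hz ⟨b + 2, by omega⟩ (by simp)
        simp [toffoliMap, Fin.ext_iff, this]
      rw [h2, hψ', weight_toffoli, hχ, weight_had hcoin, e1, e2, pow_succ, mul_inv]
      ring
    · have e : ∀ c, weight ψ (fun z => toffoliMap ⟨b, by omega⟩ ⟨b + 1, by omega⟩
          ⟨b + 2, by omega⟩ (Function.update z ⟨b + 1, by omega⟩ c) ⟨0, by omega⟩ = false)
          = weight ψ (fun z => z ⟨0, by omega⟩ = false) := fun c => by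
        refine weight_congr fun z _ => ?_
        simp [toffoliMap, Fin.ext_iff]
      rw [h3, hψ', weight_toffoli, hχ, weight_had hcoin, e, e]
      ring

/-- The circuit that computes the postselection bit from the output on wire `0`, with `k` coins on
wires from `b` on, and puts it on wire `1`: the bit is set if the output is `0` or if all coins
show `1`. Two CNOT gates suffice to move it to wire `1`, since the old content of that wire may be
left anywhere. -/
def postCircuit (b k : ℕ) (hb : 2 ≤ b) (h : b + 2 * k < N) : Circuit N :=
  [.cnot ⟨0, by omega⟩ ⟨b, by omega⟩ (by simp [Fin.ext_iff]; omega)] ++ coinChain b k h ++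
    notCircuit ⟨b + 2 * k, h⟩ ++
    [.cnot ⟨0, by omega⟩ ⟨b + 2 * k, h⟩ (by simp [Fin.ext_iff]; omega),
      .cnot ⟨1, by omega⟩ ⟨b + 2 * k, h⟩ (by simp [Fin.ext_iff]; omega),
      .cnot ⟨b + 2 * k, h⟩ ⟨1, by omega⟩ (by simp [Fin.ext_iff]; omega)]

/-- If the wires from `b` on are in state `|0⟩`, the postselection bit is set on rejection and, on
acceptance, with probability `2⁻ᵏ`. -/
lemma postCircuit_spec {b k : ℕ} (hb : 2 ≤ b) (h : b + 2 * k < N) {φ : Bits N → ℂ}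
    (hzero : ∀ z, φ z ≠ 0 → ∀ j : Fin N, b ≤ j → z j = false) :
    weight ((postCircuit b k hb h).op *ᵥ φ)
        (fun z => z ⟨0, by omega⟩ = true ∧ z ⟨1, by omega⟩ = true)
      = (2 ^ k)⁻¹ * weight φ (fun z => z ⟨0, by omega⟩ = true) ∧
    weight ((postCircuit b k hb h).op *ᵥ φ) (fun z => z ⟨1, by omega⟩ = true)
      = weight φ (fun z => z ⟨0, by omega⟩ = false)
        + (2 ^ k)⁻¹ * weight φ (fun z => z ⟨0, by omega⟩ = true) := by
  have hb0 : b ≠ 0 := by omega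
  have hbk0 : b + 2 * k ≠ 0 := by omega
  have hbk1 : b + 2 * k ≠ 1 := by omega
  set ψ := (Gate.cnot ⟨0, by omega⟩ ⟨b, by omega⟩ (by simp [Fin.ext_iff]; omega) : Gate N).op *ᵥ φ
    with hψ
  have hsupp : ∀ z, ψ z ≠ 0 → ∃ y, φ y ≠ 0 ∧ (∀ j : Fin N, j.1 ≠ b → z j = y j) ∧
      z ⟨b, by omega⟩ = z ⟨0, by omega⟩ := by
    intro z hz
    rw [hψ, cnot_mulVec] at hz
    refine ⟨_, hz, fun j hj => ?_, ?_⟩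
    · simp [cnotMap, Fin.ext_iff, hj]
    · simpa [cnotMap] using hzero _ hz ⟨b, by omega⟩ le_rfl
  obtain ⟨h1, h2, h3⟩ := coinChain_spec (b := b) (k := k) (ψ := ψ) h (by omega)
    (fun z hz j hj => by
      obtain ⟨y, hy, hzy, -⟩ := hsupp z hz
      rw [hzy j (by omega)]
      exact hzero y hy j (by omega))
    (fun z hz hzb => by
      obtain ⟨y, hy, hzy, hzb'⟩ := hsupp z hz
      rwa [← hzb'])
  have e1 : weight ψ (fun z => z ⟨b, by omega⟩ = true)
      = weight φ (fun z => z ⟨0, by omega⟩ = true) := by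
    rw [hψ, weight_cnot]
    refine weight_congr fun z hz => ?_
    simp [cnotMap, hzero z hz ⟨b, by omega⟩ le_rfl]
  have e2 : weight ψ (fun z => z ⟨0, by omega⟩ = false)
      = weight φ (fun z => z ⟨0, by omega⟩ = false) := by
    rw [hψ, weight_cnot]
    refine weight_congr fun z hz => ?_
    simp [cnotMap, Fin.ext_iff, hb0.symm]
  rw [e1] at h2
  rw [e2] at h3
  set χ := (coinChain b k h).op *ᵥ ψ with hχ
  have hop : (postCircuit b k hb h).op *ᵥ φ = (Gate.cnot ⟨b + 2 * k, h⟩ ⟨1, by omega⟩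
      (by simp [Fin.ext_iff]; omega) : Gate N).op *ᵥ ((Gate.cnot ⟨1, by omega⟩ ⟨b + 2 * k, h⟩
      (by simp [Fin.ext_iff]; omega) : Gate N).op *ᵥ ((Gate.cnot ⟨0, by omega⟩ ⟨b + 2 * k, h⟩
      (by simp [Fin.ext_iff]; omega) : Gate N).op *ᵥ
        ((notCircuit ⟨b + 2 * k, h⟩).op *ᵥ χ))) := by
    simp only [postCircuit, Circuit.op_append, Circuit.op, Matrix.one_mul, ← Matrix.mulVec_mulVec,
      hψ, hχ]
  rw [hop]
  simp only [weight_cnot, weight_notCircuit]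
  constructor
  · rw [← h2]
    refine weight_congr fun z hz => ?_
    have := h1 z hz
    simp [cnotMap, Fin.ext_iff, hbk0.symm, hbk1.symm]
    revert this
    cases z ⟨0, by omega⟩ <;> cases z ⟨1, by omega⟩ <;> cases z ⟨b + 2 * k, h⟩ <;> simp
  · rw [← h2, ← h3, ← weight_or_of_disjoint (fun z hz h' => by simp [h1 z hz h'.2] at h')]
    refine weight_congr fun z hz => ?_
    have := h1 z hz
    simp [cnotMap, Fin.ext_iff, hbk0.symm, hbk1.symm]
    revert this
    cases z ⟨0, by omega⟩ <;> cases z ⟨1, by omega⟩ <;> cases z ⟨b + 2 * k, h⟩ <;> simp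

end Chain

/-! ### Structured programs for stack machines -/

open Turing in
/-- Runs of a stack machine: `c'` is reached from `c` in at most `t` steps. -/
def RunsTo {K Λ σ : Type} [DecidableEq K] {Γ : K → Type} (m : Λ → TM2.Stmt Γ Λ σ)
    (c : TM2.Cfg Γ Λ σ) (t : ℕ) (c' : TM2.Cfg Γ Λ σ) : Prop :=
  ∃ n ≤ t, (flip bind (TM2.step m))^[n] (some c) = some c'

section Runs

open Turing

variable {K Λ Λ' σ : Type} [DecidableEq K] {Γ : K → Type}

lemma RunsTo.single {m : Λ → TM2.Stmt Γ Λ σ} {c c' : TM2.Cfg Γ Λ σ}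
    (h : TM2.step m c = some c') : RunsTo m c 1 c' :=
  ⟨1, le_rfl, by simpa [flip] using h⟩

lemma RunsTo.trans {m : Λ → TM2.Stmt Γ Λ σ} {c c' c'' : TM2.Cfg Γ Λ σ} {t t' : ℕ}
    (h : RunsTo m c t c') (h' : RunsTo m c' t' c'') : RunsTo m c (t + t') c'' := by
  obtain ⟨n, hn, e⟩ := h
  obtain ⟨n', hn', e'⟩ := h'
  refine ⟨n' + n, by omega, ?_⟩
  rw [Function.iterate_add_apply, e, e']

lemma iterate_bind_none {α : Type} (f : α → Option α) (n : ℕ) : (flip bind f)^[n] none = none := by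
  induction n with
  | zero => rfl
  | succ n ih => rw [Function.iterate_succ_apply']; rw [ih]; rfl

/-- A map of configurations that commutes with the steps of two machines carries runs to runs. -/
lemma RunsTo.map {K' σ' : Type} [DecidableEq K'] {Γ' : K' → Type} {m : Λ → TM2.Stmt Γ Λ σ}
    {m' : Λ' → TM2.Stmt Γ' Λ' σ'} {g : TM2.Cfg Γ Λ σ → TM2.Cfg Γ' Λ' σ'}
    (hg : ∀ c c', TM2.step m c = some c' → TM2.step m' (g c) = some (g c'))
    {c c' : TM2.Cfg Γ Λ σ} {t : ℕ} (h : RunsTo m c t c') : RunsTo m' (g c) t (g c') := by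
  obtain ⟨n, hn, e⟩ := h
  refine ⟨n, hn, ?_⟩
  clear hn t
  induction n generalizing c with
  | zero => simp_all
  | succ n ih =>
    rw [Function.iterate_succ_apply] at e ⊢
    cases hs : TM2.step m c with
    | none =>
      simp only [flip, Option.bind_eq_bind, Option.bind_some, hs] at e
      exact absurd ((iterate_bind_none _ n).symm.trans e) (by simp)
    | some d =>
      simp only [flip, Option.bind_eq_bind, Option.bind_some, hs] at e
      simp only [flip, Option.bind_eq_bind, Option.bind_some, hg _ _ hs]
      exact ih e

/-- Renames the labels of a statement by `f` and replaces `halt` by a jump to `e` (if any). -/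
def relabel (f : Λ → Λ') (e : Option Λ') : TM2.Stmt Γ Λ σ → TM2.Stmt Γ Λ' σ
  | .push k a q => .push k a (relabel f e q)
  | .peek k a q => .peek k a (relabel f e q)
  | .pop k a q => .pop k a (relabel f e q)
  | .load a q => .load a (relabel f e q)
  | .branch a q q' => .branch a (relabel f e q) (relabel f e q')
  | .goto l => .goto fun v => f (l v)
  | .halt => match e with
    | none => .halt
    | some l => .goto fun _ => l

/-- The effect of `relabel` on configurations. -/
def relabelCfg (f : Λ → Λ') (e : Option Λ') (c : TM2.Cfg Γ Λ σ) : TM2.Cfg Γ Λ' σ :=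
  ⟨match c.l with
    | none => e
    | some l => some (f l), c.var, c.stk⟩

lemma stepAux_relabel (f : Λ → Λ') (e : Option Λ') (q : TM2.Stmt Γ Λ σ) (v : σ)
    (S : ∀ k, List (Γ k)) :
    TM2.stepAux (relabel f e q) v S = relabelCfg f e (TM2.stepAux q v S) := by
  induction q generalizing v S with
  | push k a q ih => exact ih _ _
  | peek k a q ih => exact ih _ _
  | pop k a q ih => exact ih _ _
  | load a q ih => exact ih _ _
  | branch a q q' ih ih' =>
    simp only [relabel, TM2.stepAux]
    cases a v
    · exact ih' _ _
    · exact ih _ _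
  | goto l => rfl
  | halt => cases e <;> rfl

/-- A machine that contains a relabelled copy of the code of `m` simulates `m`. -/
lemma RunsTo.relabel {m : Λ → TM2.Stmt Γ Λ σ} {m' : Λ' → TM2.Stmt Γ Λ' σ} {f : Λ → Λ'}
    {e : Option Λ'} (hm : ∀ l, m' (f l) = relabel f e (m l)) {c c' : TM2.Cfg Γ Λ σ} {t : ℕ}
    (h : RunsTo m c t c') : RunsTo m' (relabelCfg f e c) t (relabelCfg f e c') := by
  refine h.map fun c c' hs => ?_
  obtain ⟨l, v, S⟩ := c
  cases l with
  | none => simp [TM2.step] at hs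
  | some l =>
    simp only [TM2.step, Option.some.injEq] at hs
    rw [← hs, ← stepAux_relabel, ← hm]
    rfl

/-- The number of pushes that a statement contains. -/
def pushCount : TM2.Stmt Γ Λ σ → ℕ
  | .push _ _ q => pushCount q + 1
  | .peek _ _ q => pushCount q
  | .pop _ _ q => pushCount q
  | .load _ q => pushCount q
  | .branch _ q q' => pushCount q + pushCount q'
  | .goto _ => 0
  | .halt => 0

lemma length_stepAux_le (q : TM2.Stmt Γ Λ σ) (v : σ) (S : ∀ k, List (Γ k)) (k : K) :
    ((TM2.stepAux q v S).stk k).length ≤ (S k).length + pushCount q := by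
  induction q generalizing v S with
  | push j a q ih =>
    refine (ih _ _).trans ?_
    by_cases h : k = j
    · subst h; simp [pushCount]; omega
    · simp [pushCount, h]
  | pop j a q ih =>
    refine (ih _ _).trans ?_
    by_cases h : k = j
    · subst h; simp [pushCount]
    · simp [pushCount, h]
  | peek j a q ih => exact ih _ _
  | load a q ih => exact ih _ _
  | branch a q q' ih ih' =>
    simp only [TM2.stepAux, pushCount]
    cases a v
    · exact (ih' _ _).trans (by omega)
    · exact (ih _ _).trans (by omega)
  | goto l => simp [pushCount]
  | halt => simp [pushCount]

/-- The stacks of a machine grow at most linearly in its running time. -/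
lemma RunsTo.length_le [Fintype Λ] {m : Λ → TM2.Stmt Γ Λ σ} {c c' : TM2.Cfg Γ Λ σ} {t : ℕ}
    (h : RunsTo m c t c') (k : K) :
    (c'.stk k).length ≤ (c.stk k).length + t * ∑ l, pushCount (m l) := by
  obtain ⟨n, hn, e⟩ := h
  refine le_trans ?_ (Nat.add_le_add_left (Nat.mul_le_mul_right _ hn) _)
  clear hn t
  induction n generalizing c with
  | zero => simp_all
  | succ n ih =>
    rw [Function.iterate_succ_apply] at e
    obtain ⟨l, v, S⟩ := c
    cases l with
    | none => exact absurd ((iterate_bind_none _ n).symm.trans e) (by simp)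
    | some l =>
      have h1 := ih e
      have h2 := length_stepAux_le (m l) v S k
      have h3 : pushCount (m l) ≤ ∑ l, pushCount (m l) :=
        Finset.single_le_sum (f := fun l => pushCount (m l)) (fun _ _ => Nat.zero_le _)
          (Finset.mem_univ l)
      rw [Nat.succ_mul]
      exact h1.trans (by simp only; omega)

end Runs

/-- A program for a stack machine with stack alphabets `Γ` and internal states `τ × Option A`; the
component `Option A` is a register for the symbol popped last. A program returns when it executes
`halt`. -/
structure StackProg {K : Type} (Γ : K → Type) (τ A : Type) where
  /-- the labels -/
  Λ : Type
  /-- there are finitely many labels -/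
  fin : Fintype Λ
  /-- the entry point -/
  main : Λ
  /-- the code -/
  code : Λ → Turing.TM2.Stmt Γ Λ (τ × Option A)

namespace StackProg

open Turing

variable {K : Type} {Γ : K → Type} {τ A : Type}

/-- Pushes a word on stack `k`, symbol by symbol, and clears the register. -/
def pushWord (k : K) (word : List (Γ k)) : StackProg Γ τ A where
  Λ := Unit
  fin := inferInstance
  main := ()
  code _ := word.foldr (fun a q => .push k (fun _ => a) q) (.load (fun v => (v.1, none)) .halt)

/-- Pushes the (translated) content of the register on stack `k` and clears the register. -/
def pushReg (k : K) (f : Option A → Γ k) : StackProg Γ τ A where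
  Λ := Unit
  fin := inferInstance
  main := ()
  code _ := .push k (fun v => f v.2) (.load (fun v => (v.1, none)) .halt)

/-- Sequential composition. -/
def seq (P Q : StackProg Γ τ A) : StackProg Γ τ A where
  Λ := P.Λ ⊕ Q.Λ
  fin := letI := P.fin; letI := Q.fin; inferInstance
  main := .inl P.main
  code
    | .inl l => relabel .inl (some (.inr Q.main)) (P.code l)
    | .inr l => relabel .inr none (Q.code l)

/-- Pops stack `k` until it is empty, and runs `body` after each pop, with the (translated) popped
symbol in the register. -/
def loop (k : K) (f : Γ k → A) (body : StackProg Γ τ A) : StackProg Γ τ A where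
  Λ := Option body.Λ
  fin := letI := body.fin; inferInstance
  main := none
  code
    | none => .pop k (fun v a => (v.1, a.map f))
        (.branch (fun v => v.2.isSome) (.goto fun _ => some body.main) .halt)
    | some l => relabel some (some none) (body.code l)

variable [DecidableEq K] (v₀ : τ)

/-- Started with register `reg` and stacks `T`, the program returns within `t` steps with empty
register and stacks `T'`. The component of the internal state in `τ` is `v₀` before and after. -/
def Exec (P : StackProg Γ τ A) (reg : Option A) (T : ∀ k, List (Γ k)) (t : ℕ)
    (T' : ∀ k, List (Γ k)) : Prop :=
  RunsTo P.code ⟨some P.main, (v₀, reg), T⟩ t ⟨none, (v₀, none), T'⟩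

variable {v₀}

lemma Exec.mono {P : StackProg Γ τ A} {reg : Option A} {T T' T'' : ∀ k, List (Γ k)} {t t' : ℕ}
    (h : P.Exec v₀ reg T t T') (ht : t ≤ t') (hT : T' = T'') : P.Exec v₀ reg T t' T'' := by
  subst hT
  obtain ⟨n, hn, e⟩ := h
  exact ⟨n, hn.trans ht, e⟩

lemma Exec.seq {P Q : StackProg Γ τ A} {reg : Option A} {T T' T'' : ∀ k, List (Γ k)} {t t' : ℕ}
    (h : P.Exec v₀ reg T t T') (h' : Q.Exec v₀ none T' t' T'') :
    (P.seq Q).Exec v₀ reg T (t + t') T'' := by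
  have h1 := RunsTo.relabel (m' := (P.seq Q).code) (f := Sum.inl) (fun _ => rfl) h
  have h2 := RunsTo.relabel (m' := (P.seq Q).code) (f := Sum.inr) (fun _ => rfl) h'
  exact RunsTo.trans h1 h2

lemma exec_pushWord (k : K) (word : List (Γ k)) (reg : Option A) (T : ∀ k, List (Γ k)) :
    (pushWord k word).Exec v₀ reg T 1 (Function.update T k (word.reverse ++ T k)) := by
  refine RunsTo.single ?_
  simp only [pushWord, TM2.step, Option.some.injEq]
  induction word generalizing T with
  | nil => simp [TM2.stepAux]
  | cons a word ih => simp [TM2.stepAux, ih]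

lemma exec_pushReg (k : K) (f : Option A → Γ k) (reg : Option A) (T : ∀ k, List (Γ k)) :
    (pushReg k f).Exec v₀ reg T 1 (Function.update T k (f reg :: T k)) :=
  RunsTo.single rfl

lemma exec_loop_nil {k : K} {f : Γ k → A} {body : StackProg Γ τ A} {reg : Option A}
    {T : ∀ k, List (Γ k)} (h : T k = []) : (loop k f body).Exec v₀ reg T 1 T := by
  refine RunsTo.single ?_
  have : Function.update T k [] = T := by rw [← h, Function.update_eq_self]
  simp [loop, h, this]

lemma exec_loop_cons {k : K} {f : Γ k → A} {body : StackProg Γ τ A} {reg : Option A}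
    {T T' T'' : ∀ k, List (Γ k)} {a : Γ k} {s : List (Γ k)} {t t' : ℕ} (h : T k = a :: s)
    (hb : body.Exec v₀ (some (f a)) (Function.update T k s) t T')
    (hl : (loop k f body).Exec v₀ none T' t' T'') :
    (loop k f body).Exec v₀ reg T (1 + t + t') T'' := by
  have h0 : RunsTo (loop k f body).code ⟨some none, (v₀, reg), T⟩ 1
      ⟨some (some body.main), (v₀, some (f a)), Function.update T k s⟩ :=
    RunsTo.single (by simp [loop, h])
  have h1 := RunsTo.relabel (m' := (loop k f body).code) (f := some) (fun _ => rfl) hb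
  exact (h0.trans h1).trans hl

end StackProg

/-! ### Writing down the postselection circuit -/

/-- The wire number `i` in unary. -/
def wireCode (i : ℕ) : List GateSym := List.replicate i GateSym.tick ++ [GateSym.done]

/-- A text with references to the current wire `w`: a word stands for itself, and a number `o` for
the wire `w + o`. -/
def render (w : ℕ) (text : List (List GateSym ⊕ ℕ)) : List GateSym :=
  text.flatMap (Sum.elim id fun o => wireCode (w + o))

/-- The CNOT gate that starts the coin chain. -/
def firstText : List (List GateSym ⊕ ℕ) := [.inl (.cnot :: wireCode 0), .inr 0]

/-- One round of the coin chain. -/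
def roundText : List (List GateSym ⊕ ℕ) :=
  [.inl [.had], .inr 1, .inl [.toffoli], .inr 0, .inr 1, .inr 2]

/-- The gates that follow the coin chain. -/
def finalText : List (List GateSym ⊕ ℕ) :=
  [.inl [.had], .inr 0, .inl [.phase], .inr 0, .inl [.phase], .inr 0, .inl [.had], .inr 0,
    .inl (.cnot :: wireCode 0), .inr 0, .inl (.cnot :: wireCode 1), .inr 0, .inl [.cnot], .inr 0,
    .inl (wireCode 1)]

/-- The description of the coin chain with `k` coins from wire `b` on. -/
def chainCode : ℕ → ℕ → List GateSym
  | _, 0 => []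
  | b, k + 1 => render b roundText ++ chainCode (b + 2) k

/-- The description of the postselection circuit with `k` coins on wires from `k` on. -/
def postCode (k : ℕ) : List GateSym :=
  render k firstText ++ chainCode k k ++ render (k + 2 * k) finalText

lemma encode_coinChain {N b k : ℕ} (h : b + 2 * k < N) :
    Circuit.encode (coinChain b k h) = chainCode b k := by
  induction k generalizing b with
  | zero => rfl
  | succ k ih =>
    rw [coinChain, chainCode, ← ih (b := b + 2) (by omega)]
    simp [Circuit.encode, Gate.encode, render, roundText, wireCode, encodeWire]

lemma encode_postCircuit {N k : ℕ} (hk : 2 ≤ k) (h : k + 2 * k < N) :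
    Circuit.encode (postCircuit k k hk h) = postCode k := by
  simp only [postCircuit, Circuit.encode_append, encode_coinChain]
  simp [Circuit.encode, Gate.encode, postCode, render, firstText, finalText, notCircuit, wireCode, encodeWire]

lemma length_chainCode_le {b k B : ℕ} (h : b + 2 * k ≤ B) :
    (chainCode b k).length ≤ k * (4 * B + 6) := by
  induction k generalizing b with
  | zero => simp [chainCode]
  | succ k ih =>
    have := ih (b := b + 2) (by omega)
    simp [chainCode, render, roundText, wireCode]
    nlinarith

lemma length_postCode_le (k : ℕ) :
    (postCode k).length ≤ k * (12 * k + 6) + 22 * k + 30 := by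
  have := length_chainCode_le (b := k) (k := k) (B := 3 * k) (by omega)
  simp [postCode, render, firstText, finalText, wireCode]
  nlinarith

/-- The auxiliary stacks: `D` holds the input length in unary, `U` the number of coins still to be
tossed, `W` the number of the current wire, and `R` the reversed output; `E` and `V` are scratch
space. -/
inductive AuxStack : Type
  | D | E | U | V | W | R
  deriving DecidableEq

instance : Fintype AuxStack where
  elems := ⟨([.D, .E, .U, .V, .W, .R] : List AuxStack), by simp⟩
  complete a := by cases a <;> simp

instance : Fintype GateSym where
  elems := ⟨([.had, .phase, .phaseInv, .cnot, .toffoli, .tick, .done] : List GateSym), by simp⟩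
  complete a := by cases a <;> simp

section Machine

open Turing StackProg

variable {K : Type} [DecidableEq K] {Γ : K → Type} {τ : Type} {v₀ : τ}

/-- The alphabets of a family of stacks, enlarged by the auxiliary stacks. -/
abbrev WithAux (Γ : K → Type) : K ⊕ AuxStack → Type
  | .inl k => Γ k
  | .inr _ => GateSym

/-- The contents of the auxiliary stacks: the numbers `d`, `e`, `u`, `v`, `w` in unary, and the
word `r`. -/
def auxMem (d e u v w : ℕ) (r : List GateSym) : AuxStack → List GateSym
  | .D => List.replicate d .tick
  | .E => List.replicate e .tick
  | .U => List.replicate u .tick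
  | .V => List.replicate v .tick
  | .W => List.replicate w .tick
  | .R => r

/-- Joint contents of the stacks. -/
def joint (S : ∀ k, List (Γ k)) (A : AuxStack → List GateSym) : ∀ k, List (WithAux Γ k)
  | .inl k => S k
  | .inr a => A a

/-- The stacks that are empty except for stack `k`. -/
def onlyStack (k : K) (l : List (Γ k)) : ∀ k, List (Γ k) := Function.update (fun _ => []) k l

section Update

variable {S : ∀ k, List (Γ k)} {A : AuxStack → List GateSym} {d e u v w : ℕ} {r : List GateSym}

lemma update_joint_inl (k : K) (l : List (Γ k)) :
    Function.update (joint S A) (.inl k) l = joint (Function.update S k l) A := by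
  funext j
  rcases j with j | j
  · by_cases h : j = k
    · subst h; simp [joint]
    · simp [joint, h]
  · simp [joint]

lemma update_joint_inr (a : AuxStack) (l : List GateSym) :
    Function.update (joint S A) (.inr a) l = joint S (Function.update A a l) := by
  funext j
  rcases j with j | j
  · simp [joint]
  · by_cases h : j = a
    · subst h; simp [joint]
    · simp [joint, h]

lemma update_onlyStack (k : K) (l l' : List (Γ k)) :
    Function.update (onlyStack k l) k l' = onlyStack k l' := by
  simp [onlyStack]

lemma update_D (n : ℕ) : Function.update (joint S (auxMem d e u v w r)) (.inr .D)
    (List.replicate n .tick) = joint S (auxMem n e u v w r) := by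
  rw [update_joint_inr]; congr 1; funext a; cases a <;> rfl

lemma update_E (n : ℕ) : Function.update (joint S (auxMem d e u v w r)) (.inr .E)
    (List.replicate n .tick) = joint S (auxMem d n u v w r) := by
  rw [update_joint_inr]; congr 1; funext a; cases a <;> rfl

lemma update_U (n : ℕ) : Function.update (joint S (auxMem d e u v w r)) (.inr .U)
    (List.replicate n .tick) = joint S (auxMem d e n v w r) := by
  rw [update_joint_inr]; congr 1; funext a; cases a <;> rfl

lemma update_V (n : ℕ) : Function.update (joint S (auxMem d e u v w r)) (.inr .V)
    (List.replicate n .tick) = joint S (auxMem d e u n w r) := by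
  rw [update_joint_inr]; congr 1; funext a; cases a <;> rfl

lemma update_W (n : ℕ) : Function.update (joint S (auxMem d e u v w r)) (.inr .W)
    (List.replicate n .tick) = joint S (auxMem d e u v n r) := by
  rw [update_joint_inr]; congr 1; funext a; cases a <;> rfl

lemma update_R (l : List GateSym) : Function.update (joint S (auxMem d e u v w r)) (.inr .R) l
    = joint S (auxMem d e u v w l) := by
  rw [update_joint_inr]; congr 1; funext a; cases a <;> rfl

end Update

/-- Adds `n` to the number on an auxiliary stack. -/
def addTicks (Γ : K → Type) (τ : Type) (a : AuxStack) (n : ℕ) :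
    StackProg (WithAux Γ) τ GateSym :=
  pushWord (.inr a) (List.replicate n .tick)

/-- Appends a word to the output. -/
def emit (Γ : K → Type) (τ : Type) (word : List GateSym) : StackProg (WithAux Γ) τ GateSym :=
  pushWord (.inr .R) word

/-- A loop that counts down an auxiliary stack. -/
def countdown (a : AuxStack) (body : StackProg (WithAux Γ) τ GateSym) :
    StackProg (WithAux Γ) τ GateSym :=
  loop (.inr a) id body

section Exec

variable {S : ∀ k, List (Γ k)} {d e u v w : ℕ} {r : List GateSym} {reg : Option GateSym}

lemma exec_emit (word : List GateSym) :
    (emit Γ τ word).Exec v₀ reg (joint S (auxMem d e u v w r)) 1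
      (joint S (auxMem d e u v w (word.reverse ++ r))) :=
  (exec_pushWord (Γ := WithAux Γ) (Sum.inr AuxStack.R) word reg _).mono le_rfl (update_R _)

lemma exec_addTicks (a : AuxStack) (n : ℕ) {A : AuxStack → List GateSym} :
    (addTicks Γ τ a n).Exec v₀ reg (joint S A) 1
      (Function.update (joint S A) (.inr a) (List.replicate n .tick ++ A a)) :=
  (exec_pushWord (Γ := WithAux Γ) (Sum.inr a) _ reg _).mono le_rfl (by rw [List.reverse_replicate]; rfl)

lemma exec_addTicks_D (n : ℕ) : (addTicks Γ τ .D n).Exec v₀ reg (joint S (auxMem d e u v w r)) 1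
    (joint S (auxMem (n + d) e u v w r)) :=
  (exec_addTicks .D n).mono le_rfl (by rw [auxMem, ← List.replicate_add, update_D])

lemma exec_addTicks_E (n : ℕ) : (addTicks Γ τ .E n).Exec v₀ reg (joint S (auxMem d e u v w r)) 1
    (joint S (auxMem d (n + e) u v w r)) :=
  (exec_addTicks .E n).mono le_rfl (by rw [auxMem, ← List.replicate_add, update_E])

lemma exec_addTicks_U (n : ℕ) : (addTicks Γ τ .U n).Exec v₀ reg (joint S (auxMem d e u v w r)) 1
    (joint S (auxMem d e (n + u) v w r)) :=
  (exec_addTicks .U n).mono le_rfl (by rw [auxMem, ← List.replicate_add, update_U])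

lemma exec_addTicks_V (n : ℕ) : (addTicks Γ τ .V n).Exec v₀ reg (joint S (auxMem d e u v w r)) 1
    (joint S (auxMem d e u (n + v) w r)) :=
  (exec_addTicks .V n).mono le_rfl (by rw [auxMem, ← List.replicate_add, update_V])

lemma exec_addTicks_W (n : ℕ) : (addTicks Γ τ .W n).Exec v₀ reg (joint S (auxMem d e u v w r)) 1
    (joint S (auxMem d e u v (n + w) r)) :=
  (exec_addTicks .W n).mono le_rfl (by rw [auxMem, ← List.replicate_add, update_W])

variable {body : StackProg (WithAux Γ) τ GateSym}

/-- The loop rule for a countdown: `F i` describes the stacks, apart from the counter, when `i`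
rounds remain. -/
lemma exec_countdown {a : AuxStack} {T : ℕ → ∀ k, List (WithAux Γ k)} {n t : ℕ}
    (h0 : T 0 (.inr a) = [])
    (hT : ∀ i < n, T (i + 1) (.inr a) = List.replicate (i + 1) .tick)
    (hb : ∀ i < n, body.Exec v₀ (some .tick)
      (Function.update (T (i + 1)) (.inr a) (List.replicate i .tick)) t (T i)) :
    (countdown a body).Exec v₀ reg (T n) (n * (t + 1) + 1) (T 0) := by
  induction n generalizing reg with
  | zero => exact (exec_loop_nil h0).mono (by omega) rfl
  | succ n ih =>
    refine (exec_loop_cons (hT n (Nat.lt_succ_self n)) (hb n (Nat.lt_succ_self n))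
      (ih (fun i hi => hT i (by omega)) fun i hi => hb i (by omega))).mono ?_ rfl
    rw [Nat.succ_mul]; omega


/-- Moves the number on `W` to `E` and appends it in unary to the output. -/
lemma exec_spend_W :
    (countdown .W ((emit Γ τ [.tick]).seq (addTicks Γ τ .E 1))).Exec v₀ reg
      (joint S (auxMem d e u v w r)) (w * 3 + 1)
      (joint S (auxMem d (w + e) u v 0 (List.replicate w .tick ++ r))) := by
  have := exec_countdown (v₀ := v₀) (reg := reg) (a := .W) (n := w) (t := 2)
    (body := (emit Γ τ [.tick]).seq (addTicks Γ τ .E 1))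
    (T := fun i => joint S (auxMem d (w - i + e) u v i (List.replicate (w - i) .tick ++ r)))
    rfl (fun _ _ => rfl) fun i hi => by
      rw [update_W]
      refine ((exec_emit _).seq (exec_addTicks_E 1)).mono le_rfl ?_
      rw [show w - i = w - (i + 1) + 1 by omega, List.replicate_succ,
        show 1 + (w - (i + 1) + e) = w - (i + 1) + 1 + e by omega]
      rfl
  simpa using this

lemma exec_E_to_W :
    (countdown .E (addTicks Γ τ .W 1)).Exec v₀ reg (joint S (auxMem d e u v w r)) (e * 2 + 1)
      (joint S (auxMem d 0 u v (e + w) r)) := by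
  have := exec_countdown (v₀ := v₀) (reg := reg) (a := .E) (n := e) (t := 1)
    (body := addTicks Γ τ .W 1) (T := fun i => joint S (auxMem d i u v (e - i + w) r))
    rfl (fun _ _ => rfl) fun i hi => by
      rw [update_E]
      refine (exec_addTicks_W 1).mono le_rfl ?_
      rw [show 1 + (e - (i + 1) + w) = e - i + w by omega]
  simpa using this

lemma exec_E_to_D :
    (countdown .E (addTicks Γ τ .D 1)).Exec v₀ reg (joint S (auxMem d e u v w r)) (e * 2 + 1)
      (joint S (auxMem (e + d) 0 u v w r)) := by
  have := exec_countdown (v₀ := v₀) (reg := reg) (a := .E) (n := e) (t := 1)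
    (body := addTicks Γ τ .D 1) (T := fun i => joint S (auxMem (e - i + d) i u v w r))
    rfl (fun _ _ => rfl) fun i hi => by
      rw [update_E]
      refine (exec_addTicks_D 1).mono le_rfl ?_
      rw [show 1 + (e - (i + 1) + d) = e - i + d by omega]
  simpa using this

lemma exec_V_to_U :
    (countdown .V (addTicks Γ τ .U 1)).Exec v₀ reg (joint S (auxMem d e u v w r)) (v * 2 + 1)
      (joint S (auxMem d e (v + u) 0 w r)) := by
  have := exec_countdown (v₀ := v₀) (reg := reg) (a := .V) (n := v) (t := 1)
    (body := addTicks Γ τ .U 1) (T := fun i => joint S (auxMem d e (v - i + u) i w r))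
    rfl (fun _ _ => rfl) fun i hi => by
      rw [update_V]
      refine (exec_addTicks_U 1).mono le_rfl ?_
      rw [show 1 + (v - (i + 1) + u) = v - i + u by omega]
  simpa using this

lemma exec_U_to_V_W :
    (countdown .U ((addTicks Γ τ .V 1).seq (addTicks Γ τ .W 1))).Exec v₀ reg
      (joint S (auxMem d e u v w r)) (u * 3 + 1) (joint S (auxMem d e 0 (u + v) (u + w) r)) := by
  have := exec_countdown (v₀ := v₀) (reg := reg) (a := .U) (n := u) (t := 2)
    (body := (addTicks Γ τ .V 1).seq (addTicks Γ τ .W 1))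
    (T := fun i => joint S (auxMem d e i (u - i + v) (u - i + w) r))
    rfl (fun _ _ => rfl) fun i hi => by
      rw [update_U]
      refine ((exec_addTicks_V 1).seq (exec_addTicks_W 1)).mono le_rfl ?_
      rw [show 1 + (u - (i + 1) + v) = u - i + v by omega,
        show 1 + (u - (i + 1) + w) = u - i + w by omega]
  simpa using this

lemma exec_D_to_V_E :
    (countdown .D ((addTicks Γ τ .V 1).seq (addTicks Γ τ .E 1))).Exec v₀ reg
      (joint S (auxMem d e u v w r)) (d * 3 + 1) (joint S (auxMem 0 (d + e) u (d + v) w r)) := by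
  have := exec_countdown (v₀ := v₀) (reg := reg) (a := .D) (n := d) (t := 2)
    (body := (addTicks Γ τ .V 1).seq (addTicks Γ τ .E 1))
    (T := fun i => joint S (auxMem i (d - i + e) u (d - i + v) w r))
    rfl (fun _ _ => rfl) fun i hi => by
      rw [update_D]
      refine ((exec_addTicks_V 1).seq (exec_addTicks_E 1)).mono le_rfl ?_
      rw [show 1 + (d - (i + 1) + v) = d - i + v by omega,
        show 1 + (d - (i + 1) + e) = d - i + e by omega]
  simpa using this

lemma exec_clear_D :
    (countdown .D (addTicks Γ τ .D 0)).Exec v₀ reg (joint S (auxMem d e u v w r)) (d * 2 + 1)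
      (joint S (auxMem 0 e u v w r)) :=
  exec_countdown (T := fun i => joint S (auxMem i e u v w r)) rfl (fun _ _ => rfl) fun i hi => by
    rw [update_D]
    exact (exec_addTicks_D 0).mono le_rfl (by rw [Nat.zero_add])

lemma exec_clear_W :
    (countdown .W (addTicks Γ τ .W 0)).Exec v₀ reg (joint S (auxMem d e u v w r)) (w * 2 + 1)
      (joint S (auxMem d e u v 0 r)) :=
  exec_countdown (T := fun i => joint S (auxMem d e u v i r)) rfl (fun _ _ => rfl) fun i hi => by
    rw [update_W]
    exact (exec_addTicks_W 0).mono le_rfl (by rw [Nat.zero_add])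

/-- Multiplies the number on `U` by one more than the number on `D`. -/
def mulProg (Γ : K → Type) (τ : Type) : StackProg (WithAux Γ) τ GateSym :=
  (countdown .U ((addTicks Γ τ .V 1).seq
    ((countdown .D ((addTicks Γ τ .V 1).seq (addTicks Γ τ .E 1))).seq
      (countdown .E (addTicks Γ τ .D 1))))).seq
  (countdown .V (addTicks Γ τ .U 1))

lemma exec_mulProg :
    (mulProg Γ τ).Exec v₀ reg (joint S (auxMem d 0 u 0 w r))
      (u * (d * 5 + 4) + 1 + (u * (d + 1) * 2 + 1)) (joint S (auxMem d 0 (u * (d + 1)) 0 w r)) := by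
  have h := exec_countdown (v₀ := v₀) (reg := reg) (a := .U) (n := u) (t := d * 5 + 3)
    (body := (addTicks Γ τ .V 1).seq
      ((countdown .D ((addTicks Γ τ .V 1).seq (addTicks Γ τ .E 1))).seq
        (countdown .E (addTicks Γ τ .D 1))))
    (T := fun i => joint S (auxMem d 0 i ((u - i) * (d + 1)) w r))
    (by simp [joint, auxMem]) (fun _ _ => rfl) fun i hi => by
      rw [update_U]
      refine ((exec_addTicks_V 1).seq (exec_D_to_V_E.seq exec_E_to_D)).mono (by omega) ?_
      rw [show u - i = u - (i + 1) + 1 by omega, Nat.succ_mul]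
      congr 2
      omega
  simp only [Nat.sub_self, Nat.zero_mul, Nat.sub_zero] at h
  exact h.seq exec_V_to_U

/-- Puts `c * (D + 1) ^ j` on `U`, where `D` is the number on that stack. -/
def powProg (Γ : K → Type) (τ : Type) (c : ℕ) : ℕ → StackProg (WithAux Γ) τ GateSym
  | 0 => addTicks Γ τ .U c
  | j + 1 => (powProg Γ τ c j).seq (mulProg Γ τ)

lemma exec_powProg (c j : ℕ) : ∃ p : Polynomial ℕ,
    ∀ {S : ∀ k, List (Γ k)} {d w : ℕ} {r : List GateSym} {reg : Option GateSym},
    (powProg Γ τ c j).Exec v₀ reg (joint S (auxMem d 0 0 0 w r)) (p.eval d)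
      (joint S (auxMem d 0 (c * (d + 1) ^ j) 0 w r)) := by
  induction j with
  | zero =>
    refine ⟨1, fun {S d w r reg} => ?_⟩
    exact (exec_addTicks_U c).mono (by simp) (by simp)
  | succ j ih =>
    obtain ⟨p, hp⟩ := ih
    let q : Polynomial ℕ := .C c * (.X + 1) ^ j
    refine ⟨p + (q * (.X * 5 + 4) + 1 + (q * (.X + 1) * 2 + 1)), fun {S d w r reg} => ?_⟩
    refine (hp.seq exec_mulProg).mono (by simp [q]) ?_
    rw [pow_succ, mul_assoc]

/-- Appends a text to the output, with the wire number taken from `W`. -/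
def emitText (Γ : K → Type) (τ : Type) :
    List (List GateSym ⊕ ℕ) → StackProg (WithAux Γ) τ GateSym
  | [] => emit Γ τ []
  | .inl word :: text => (emit Γ τ word).seq (emitText Γ τ text)
  | .inr o :: text =>
    ((countdown .W ((emit Γ τ [.tick]).seq (addTicks Γ τ .E 1))).seq
      ((countdown .E (addTicks Γ τ .W 1)).seq
        (emit Γ τ (List.replicate o .tick ++ [.done])))).seq (emitText Γ τ text)

lemma exec_emitText (text : List (List GateSym ⊕ ℕ)) :
    (emitText Γ τ text).Exec v₀ reg (joint S (auxMem d 0 u v w r))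
      (text.length * (w * 5 + 3) + 1) (joint S (auxMem d 0 u v w ((render w text).reverse ++ r))) := by
  induction text generalizing r reg with
  | nil => exact (exec_emit []).mono (by simp) (by simp [render])
  | cons s text ih =>
    rcases s with word | o
    · refine ((exec_emit word).seq ih).mono ?_ (by simp [render])
      rw [List.length_cons, Nat.succ_mul]; omega
    · refine ((exec_spend_W.seq (exec_E_to_W.seq (exec_emit _))).seq ih).mono ?_ ?_
      · rw [List.length_cons, Nat.succ_mul]; omega
      · congr 2
        simp only [render, List.flatMap_cons, Sum.elim_inr, wireCode,
          List.replicate_add, List.reverse_append, List.reverse_replicate, List.append_assoc]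

/-- Appends the description of the coin chain to the output. -/
def chainProg (Γ : K → Type) (τ : Type) : StackProg (WithAux Γ) τ GateSym :=
  countdown .U ((emitText Γ τ roundText).seq (addTicks Γ τ .W 2))

lemma exec_chainProg {B : ℕ} (h : w + 2 * u ≤ B) :
    (chainProg Γ τ).Exec v₀ reg (joint S (auxMem d 0 u v w r)) (u * (B * 30 + 21) + 1)
      (joint S (auxMem d 0 0 v (w + 2 * u) ((chainCode w u).reverse ++ r))) := by
  induction u generalizing w r reg with
  | zero => exact (exec_loop_nil rfl).mono (by omega) (by simp [chainCode])
  | succ u ih =>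
    have hround : ((emitText Γ τ roundText).seq (addTicks Γ τ .W 2)).Exec v₀ (some .tick)
        (Function.update (joint S (auxMem d 0 (u + 1) v w r)) (.inr .U) (List.replicate u .tick))
        (6 * (w * 5 + 3) + 1 + 1)
        (joint S (auxMem d 0 u v (2 + w) ((render w roundText).reverse ++ r))) := by
      rw [update_U]
      exact (exec_emitText roundText).seq (exec_addTicks_W 2)
    refine (exec_loop_cons (a := GateSym.tick) (s := List.replicate u .tick) rfl hround
      (ih (w := 2 + w) (by omega))).mono ?_ ?_
    · rw [Nat.succ_mul u]; omega
    · rw [chainCode, List.reverse_append, List.append_assoc, Nat.add_comm 2 w,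
        show w + 2 + 2 * u = w + 2 * (u + 1) by omega]

/-- Appends the description of the postselection circuit with `c * (D + 1) ^ j` coins to the
output, where `D` is the number on that stack. -/
def postProg (Γ : K → Type) (τ : Type) (c j : ℕ) : StackProg (WithAux Γ) τ GateSym :=
  (powProg Γ τ c j).seq <|
  ((countdown .U ((addTicks Γ τ .V 1).seq (addTicks Γ τ .W 1))).seq
    (countdown .V (addTicks Γ τ .U 1))).seq <|
  (emitText Γ τ firstText).seq <| (chainProg Γ τ).seq <| (emitText Γ τ finalText).seq <|
  countdown .W (addTicks Γ τ .W 0)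

lemma exec_postProg (c j : ℕ) : ∃ p : Polynomial ℕ,
    ∀ {S : ∀ k, List (Γ k)} {d : ℕ} {r : List GateSym} {reg : Option GateSym},
    (postProg Γ τ c j).Exec v₀ reg (joint S (auxMem d 0 0 0 0 r)) (p.eval d)
      (joint S (auxMem d 0 0 0 0 ((postCode (c * (d + 1) ^ j)).reverse ++ r))) := by
  obtain ⟨p, hp⟩ := exec_powProg (Γ := Γ) (τ := τ) (v₀ := v₀) c j
  let q : Polynomial ℕ := .C c * (.X + 1) ^ j
  refine ⟨p + ((q * 3 + 1 + (q * 2 + 1)) + ((2 * (q * 5 + 3) + 1) + ((q * (3 * q * 30 + 21) + 1) +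
    ((15 * (3 * q * 5 + 3) + 1) + (3 * q * 2 + 1))))), fun {S d r reg} => ?_⟩
  refine (hp.seq ((exec_U_to_V_W.seq exec_V_to_U).seq ((exec_emitText _).seq
    ((exec_chainProg (B := 3 * (c * (d + 1) ^ j)) (by omega)).seq
      ((exec_emitText _).seq exec_clear_W))))).mono ?_ ?_
  · simp only [Polynomial.eval_add, Polynomial.eval_mul, Polynomial.eval_pow, Polynomial.eval_C,
      Polynomial.eval_X, Polynomial.eval_one, Polynomial.eval_ofNat, q, firstText, finalText,
      List.length_cons, List.length_nil, Nat.add_zero]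
    omega
  · simp [postCode]

end Exec
end Machine

/-! ### A machine that appends the postselection circuit -/

section Append

open Turing StackProg

variable {K Λ σ : Type} {Γ : K → Type}

/-- A statement of a machine without auxiliary stacks, for the machine with auxiliary stacks. -/
def liftStmt : TM2.Stmt Γ Λ σ → TM2.Stmt (WithAux Γ) Λ (σ × Option GateSym)
  | .push k f q => .push (.inl k) (fun v => f v.1) (liftStmt q)
  | .peek k f q => .peek (.inl k) (fun v a => (f v.1 a, v.2)) (liftStmt q)
  | .pop k f q => .pop (.inl k) (fun v a => (f v.1 a, v.2)) (liftStmt q)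
  | .load f q => .load (fun v => (f v.1, v.2)) (liftStmt q)
  | .branch f q q' => .branch (fun v => f v.1) (liftStmt q) (liftStmt q')
  | .goto l => .goto fun v => l v.1
  | .halt => .halt

lemma stepAux_liftStmt [DecidableEq K] (q : TM2.Stmt Γ Λ σ) (v : σ) (reg : Option GateSym)
    (S : ∀ k, List (Γ k)) (A : AuxStack → List GateSym) :
    TM2.stepAux (liftStmt q) (v, reg) (joint S A)
      = ⟨(TM2.stepAux q v S).l, ((TM2.stepAux q v S).var, reg),
          joint (TM2.stepAux q v S).stk A⟩ := by
  induction q generalizing v S with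
  | push k f q ih => simp only [liftStmt, TM2.stepAux, update_joint_inl]; exact ih _ _
  | peek k f q ih => exact ih _ _
  | pop k f q ih => simp only [liftStmt, TM2.stepAux, update_joint_inl]; exact ih _ _
  | load f q ih => exact ih _ _
  | branch f q q' ih ih' =>
    simp only [liftStmt, TM2.stepAux]
    cases f v
    · exact ih' _ _
    · exact ih _ _
  | goto l => rfl
  | halt => rfl

/-- A machine as a program that leaves the auxiliary stacks alone. -/
def embed (M : FinTM2) : StackProg (WithAux M.Γ) M.σ GateSym where
  Λ := M.Λ
  fin := M.ΛFin
  main := M.main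
  code l := liftStmt (M.m l)

lemma initList_eq (M : FinTM2) (s : List (M.Γ M.k₀)) :
    initList M s = ⟨some M.main, M.initialState, onlyStack M.k₀ s⟩ := by
  rw [initList]
  congr 1
  funext k
  by_cases h : k = M.k₀
  · subst h; simp [onlyStack]
  · simp [onlyStack, h]

lemma haltList_eq (M : FinTM2) (s : List (M.Γ M.k₁)) :
    haltList M s = ⟨none, M.initialState, onlyStack M.k₁ s⟩ := by
  rw [haltList]
  congr 1
  funext k
  by_cases h : k = M.k₁
  · subst h; simp [onlyStack]
  · simp [onlyStack, h]

lemma runsTo_of_outputs {M : FinTM2} {s : List (M.Γ M.k₀)} {s' : List (M.Γ M.k₁)} {t : ℕ}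
    (h : TM2OutputsInTime M s (some s') t) :
    RunsTo M.m ⟨some M.main, M.initialState, onlyStack M.k₀ s⟩ t
      ⟨none, M.initialState, onlyStack M.k₁ s'⟩ := by
  refine ⟨h.steps, h.steps_le_m, ?_⟩
  rw [← initList_eq, ← haltList_eq]
  exact h.evals_in_steps

lemma exec_embed {M : FinTM2} {s : List (M.Γ M.k₀)} {s' : List (M.Γ M.k₁)} {t : ℕ}
    (h : TM2OutputsInTime M s (some s') t) (A : AuxStack → List GateSym) :
    (embed M).Exec M.initialState none (joint (onlyStack M.k₀ s) A) t
      (joint (onlyStack M.k₁ s') A) := by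
  refine RunsTo.map (m := M.m) (m' := (embed M).code)
    (g := fun c => ⟨c.l, (c.var, none), joint c.stk A⟩) (fun c c' hs => ?_) (runsTo_of_outputs h)
  obtain ⟨l, v, S⟩ := c
  cases l with
  | none => simp [TM2.step] at hs
  | some l =>
    simp only [TM2.step, Option.some.injEq] at hs ⊢
    rw [← hs]
    exact stepAux_liftStmt _ _ _ _ _

variable [DecidableEq K] {τ : Type} {v₀ : τ} {d e u v w : ℕ} {r : List GateSym}
  {reg : Option GateSym}

lemma joint_onlyStack_self {k : K} {l : List (Γ k)} {A : AuxStack → List GateSym} :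
    joint (onlyStack k l) A (.inl k) = l :=
  Function.update_self (β := fun k => List (Γ k)) k l fun _ => []

lemma length_onlyStack_le (k k' : K) (l : List (Γ k)) : (onlyStack k l k').length ≤ l.length := by
  by_cases h : k' = k
  · subst h; simp [onlyStack]
  · simp [onlyStack, h]

/-- Moves stack `k` to `R`, and adds `i` to `D` for each symbol. -/
def unload (τ : Type) (k : K) (f : Γ k → GateSym) (i : ℕ) : StackProg (WithAux Γ) τ GateSym :=
  loop (.inl k) f ((pushReg (Γ := WithAux Γ) (.inr .R) fun reg => reg.getD .tick).seq (addTicks Γ τ .D i))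

lemma exec_unload {k : K} {f : Γ k → GateSym} {i : ℕ} (l : List (Γ k)) :
    (unload τ k f i).Exec v₀ reg (joint (onlyStack k l) (auxMem d e u v w r)) (l.length * 3 + 1)
      (joint (onlyStack k []) (auxMem (l.length * i + d) e u v w ((l.map f).reverse ++ r))) := by
  induction l generalizing d r reg with
  | nil =>
    exact (exec_loop_nil joint_onlyStack_self).mono (by simp) (by simp)
  | cons a l ih =>
    have hbody : ((pushReg (Γ := WithAux Γ) (.inr .R) fun reg => reg.getD .tick).seq
        (addTicks Γ τ .D i)).Exec v₀ (some (f a))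
        (Function.update (joint (onlyStack k (a :: l)) (auxMem d e u v w r)) (.inl k) l) (1 + 1)
        (joint (onlyStack k l) (auxMem (i + d) e u v w (f a :: r))) := by
      rw [update_joint_inl, update_onlyStack]
      exact ((exec_pushReg (Γ := WithAux Γ) (Sum.inr AuxStack.R) _ _ _).mono le_rfl
        (update_R _)).seq (exec_addTicks_D i)
    refine (exec_loop_cons (Γ := WithAux Γ) (k := Sum.inl k) (a := a) (s := l) joint_onlyStack_self hbody ih).mono ?_ ?_
    · rw [List.length_cons]; omega
    · rw [List.length_cons, Nat.succ_mul, Nat.add_assoc]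
      simp

/-- Moves `R` to stack `k`. -/
def reload (τ : Type) (k : K) (g : GateSym → Γ k) : StackProg (WithAux Γ) τ GateSym :=
  loop (.inr .R) id (pushReg (.inl k) fun reg => g (reg.getD .tick))

lemma exec_reload {k : K} {g : GateSym → Γ k} (l : List (Γ k)) :
    (reload τ k g).Exec v₀ reg (joint (onlyStack k l) (auxMem d e u v w r)) (r.length * 2 + 1)
      (joint (onlyStack k ((r.map g).reverse ++ l)) (auxMem d e u v w [])) := by
  induction r generalizing l reg with
  | nil => exact (exec_loop_nil rfl).mono (by simp) (by simp)
  | cons a r ih =>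
    have hbody : (pushReg (Γ := WithAux Γ) (.inl k) fun reg => g (reg.getD .tick)).Exec v₀
        (some a) (Function.update (joint (onlyStack k l) (auxMem d e u v w (a :: r))) (.inr .R) r) 1
        (joint (onlyStack k (g a :: l)) (auxMem d e u v w r)) := by
      rw [update_R]
      refine (exec_pushReg (Γ := WithAux Γ) (Sum.inl k) _ _ _).mono le_rfl ?_
      rw [update_joint_inl, update_onlyStack]
      rw [joint_onlyStack_self]
      rfl
    refine (exec_loop_cons (a := a) (s := r) rfl hbody (ih _)).mono ?_ ?_
    · rw [List.length_cons]; omega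
    · simp

/-- Runs `M`, after taking down the length of the input, and appends the description of the
postselection circuit to its output. -/
def appendProg (M : FinTM2) (inp : M.Γ M.k₀ ≃ Bool) (out : M.Γ M.k₁ ≃ GateSym) (c j : ℕ) :
    StackProg (WithAux M.Γ) M.σ GateSym :=
  -- The input is copied through `R`, whose alphabet has codes for both bits.
  (unload M.σ M.k₀ (fun a => if inp a then .had else .tick) 1).seq <|
  (reload M.σ M.k₀ fun a => inp.symm (match a with | .had => true | _ => false)).seq <|
  (embed M).seq <| (unload M.σ M.k₁ out 0).seq <| (postProg M.Γ M.σ c j).seq <|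
  (countdown .D (addTicks M.Γ M.σ .D 0)).seq <| reload M.σ M.k₁ out.symm

lemma exec_appendProg (M : FinTM2) (inp : M.Γ M.k₀ ≃ Bool) (out : M.Γ M.k₁ ≃ GateSym) (c j : ℕ)
    (p : Polynomial ℕ) : ∃ q : Polynomial ℕ, ∀ (s : List (M.Γ M.k₀)) (s' : List (M.Γ M.k₁)),
      TM2OutputsInTime M s (some s') (p.eval s.length) →
      (appendProg M inp out c j).Exec M.initialState none
        (joint (onlyStack M.k₀ s) (auxMem 0 0 0 0 0 [])) (q.eval s.length)
        (joint (onlyStack M.k₁ (s' ++ (postCode (c * (s.length + 1) ^ j)).map out.symm))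
          (auxMem 0 0 0 0 0 [])) := by
  obtain ⟨p', hp'⟩ := exec_postProg (Γ := M.Γ) (τ := M.σ) (v₀ := M.initialState) c j
  have := M.ΛFin
  let κ : Polynomial ℕ := .C c * (.X + 1) ^ j
  let ℓ : Polynomial ℕ := .X + p * .C (∑ l, pushCount (M.m l))
  refine ⟨(.X * 3 + 1) + ((.X * 2 + 1) + (p + ((ℓ * 3 + 1) + (p' + ((.X * 2 + 1) +
    ((κ * (12 * κ + 6) + 22 * κ + 30 + ℓ) * 2 + 1)))))), fun s s' h => ?_⟩
  have hlen : s'.length ≤ s.length + p.eval s.length * ∑ l, pushCount (M.m l) := by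
    have := (runsTo_of_outputs h).length_le M.k₁
    have h0 := length_onlyStack_le M.k₀ M.k₁ s
    simp only [onlyStack, Function.update_self] at this h0
    omega
  have hpost := length_postCode_le (c * (s.length + 1) ^ j)
  have hcopy : ∀ a, inp.symm (match (if inp a then GateSym.had else GateSym.tick) with
      | .had => true | _ => false) = a := fun a => by
    rw [Equiv.symm_apply_eq]
    cases inp a <;> rfl
  have h1 := exec_unload (τ := M.σ) (v₀ := M.initialState) (reg := none) (d := 0) (e := 0) (u := 0)
    (v := 0) (w := 0) (r := []) (f := fun a => if inp a then .had else .tick) (i := 1) s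
  have h2 := exec_reload (τ := M.σ) (v₀ := M.initialState) (reg := none) (d := s.length * 1 + 0)
    (e := 0) (u := 0) (v := 0) (w := 0)
    (r := (s.map fun a => if inp a then GateSym.had else .tick).reverse ++ [])
    (g := fun a => inp.symm (match a with | .had => true | _ => false)) (k := M.k₀) []
  simp only [List.append_nil, List.map_reverse, List.reverse_reverse, List.map_map,
    Function.comp_def, hcopy, List.map_id'] at h2
  simp only [List.append_nil] at h1
  have h3 := exec_embed h (auxMem (s.length * 1 + 0) 0 0 0 0 [])
  have h4 := exec_unload (τ := M.σ) (v₀ := M.initialState) (reg := none) (d := s.length * 1 + 0)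
    (e := 0) (u := 0) (v := 0) (w := 0) (r := []) (f := out) (i := 0) s'
  simp only [Nat.mul_zero, Nat.zero_add, List.append_nil] at h4
  have h5 := hp' (S := onlyStack M.k₁ []) (d := s.length * 1 + 0) (r := (s'.map out).reverse)
    (reg := none)
  have h6 := exec_reload (τ := M.σ) (v₀ := M.initialState) (reg := none) (d := 0) (e := 0) (u := 0)
    (v := 0) (w := 0)
    (r := (postCode (c * (s.length * 1 + 0 + 1) ^ j)).reverse ++ (s'.map out).reverse)
    (g := out.symm) (k := M.k₁) []
  refine (h1.seq (h2.seq (h3.seq (h4.seq (h5.seq (exec_clear_D.seq h6)))))).mono ?_ ?_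
  · simp only [List.length_reverse, List.length_map, List.length_append, Polynomial.eval_add,
      Polynomial.eval_mul, Polynomial.eval_pow, Polynomial.eval_C, Polynomial.eval_X,
      Polynomial.eval_one, Polynomial.eval_ofNat, κ, ℓ, Nat.mul_one, Nat.add_zero] at hpost hlen ⊢
    omega
  · simp [List.map_reverse, Function.comp_def]

/-- A polynomial-time computation can be extended by writing down the postselection circuit for a
polynomial number of coins. -/
theorem polyTime_append_postCode {f : List Bool → List GateSym}
    (hf : Nonempty (TM2ComputableInPolyTime
      (fun x : List Bool => x) (fun y : List GateSym => y) f)) (c j : ℕ) :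
    Nonempty (TM2ComputableInPolyTime (fun x : List Bool => x) (fun y : List GateSym => y)
      fun x => f x ++ postCode (c * (x.length + 1) ^ j)) := by
  obtain ⟨⟨M, inp, out⟩, p, hM⟩ := hf
  obtain ⟨q, hq⟩ := exec_appendProg M inp out c j p
  have := M.kFin
  have := M.σFin
  have := M.Γk₀Fin
  let P := appendProg M inp out c j
  have : Fintype P.Λ := P.fin
  let N : FinTM2 :=
    { K := M.K ⊕ AuxStack
      k₀ := .inl M.k₀
      k₁ := .inl M.k₁
      Γ := WithAux M.Γ
      Λ := P.Λ
      main := P.main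
      σ := M.σ × Option GateSym
      initialState := (M.initialState, none)
      Γk₀Fin := M.Γk₀Fin
      m := P.code }
  have hjoint : ∀ (k : M.K) (s : List (M.Γ k)),
      joint (onlyStack k s) (auxMem 0 0 0 0 0 [])
        = onlyStack (Γ := WithAux M.Γ) (.inl k) s := by
    intro k s
    have h0 : joint (onlyStack k []) (auxMem 0 0 0 0 0 []) = fun k : M.K ⊕ AuxStack =>
        ([] : List (WithAux M.Γ k)) := by
      funext a
      rcases a with a | a
      · simp [joint, onlyStack]
      · cases a <;> rfl
    rw [← update_onlyStack k [] s, ← update_joint_inl, h0]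
    rfl
  have hrun : ∀ x : List Bool, RunsTo N.m
      (initList N (x.map inp.symm)) (q.eval x.length)
      (haltList N ((f x ++ postCode (c * (x.length + 1) ^ j)).map out.symm)) := by
    intro x
    have h := hM x
    have hx : (x.map inp.symm).length = x.length := List.length_map _
    have := hq (x.map inp.symm) ((f x).map out.symm) (by rw [hx]; exact h)
    rw [hx, ← List.map_append, hjoint, hjoint] at this
    rw [initList_eq, haltList_eq]
    exact this
  exact ⟨⟨⟨N, inp, out⟩, q, fun x =>
    { steps := (hrun x).choose
      steps_le_m := (hrun x).choose_spec.1
      evals_in_steps := (hrun x).choose_spec.2 }⟩⟩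

end Append

/-! ### The verifier with postselection -/

lemma eventProb_projOne {N : ℕ} (i : Fin N) (Q : QOp N) (φ : Bits N → ℂ) :
    eventProb (projOne i) Q (pureDensity φ) = weight (Q *ᵥ φ) (fun z => z i = true) :=
  eventProb_diagonal Q φ _

lemma eventProb_projOne_mul_projOne {N : ℕ} (i j : Fin N) (Q : QOp N) (φ : Bits N → ℂ) :
    eventProb (projOne i * projOne j) Q (pureDensity φ)
      = weight (Q *ᵥ φ) (fun z => z i = true ∧ z j = true) := by
  rw [← eventProb_diagonal, projOne, projOne, Matrix.diagonal_mul_diagonal]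
  congr
  funext z
  by_cases hi : z i <;> by_cases hj : z j <;> simp [hi, hj]

lemma weight_false_add_weight_true {w m : ℕ} (C : Circuit (2 * w + m)) (i : Fin (2 * w + m))
    (ψ₁ ψ₂ : PureState w) :
    weight (C.op *ᵥ inputVec m ψ₁ ψ₂) (fun z => z i = false)
      + weight (C.op *ᵥ inputVec m ψ₁ ψ₂) (fun z => z i = true) = 1 := by
  rw [← weight_or_of_disjoint (by simp), ← weight_inputVec m ψ₁ ψ₂, ← Circuit.weight_true C]
  exact weight_congr fun z _ => by simp

/-- Extending a circuit with acceptance probability `a` by the postselection circuit yields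
`Pr[o = 1, p = 1] = 2⁻ᵏ a` and `Pr[p = 1] = (1 - a) + 2⁻ᵏ a`. -/
lemma eventProb_post {w m m' k : ℕ} (C : Circuit (2 * w + m)) (h1 : 1 ≤ 2 * w + m)
    (hk : 2 * w + m ≤ k) (hk2 : 2 ≤ k) (h : 2 * w + m ≤ 2 * w + m') (hm' : k + 2 * k < 2 * w + m')
    (ψ₁ ψ₂ : PureState w) :
    eventProb (projOne ⟨0, by omega⟩ * projOne ⟨1, by omega⟩)
        (Circuit.op (C.lift h ++ postCircuit k k hk2 hm')) (pureDensity (inputVec m' ψ₁ ψ₂))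
      = (2 ^ k)⁻¹ * eventProb (projOne ⟨0, h1⟩) (Circuit.op C) (pureDensity (inputVec m ψ₁ ψ₂)) ∧
    eventProb (projOne ⟨1, by omega⟩)
        (Circuit.op (C.lift h ++ postCircuit k k hk2 hm')) (pureDensity (inputVec m' ψ₁ ψ₂))
      = 1 - eventProb (projOne ⟨0, h1⟩) (Circuit.op C) (pureDensity (inputVec m ψ₁ ψ₂)) +
        (2 ^ k)⁻¹ * eventProb (projOne ⟨0, h1⟩) (Circuit.op C) (pureDensity (inputVec m ψ₁ ψ₂)) := by
  set φ := Circuit.op C *ᵥ inputVec m ψ₁ ψ₂ with hφ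
  have hout : Circuit.op (C.lift h ++ postCircuit k k hk2 hm') *ᵥ inputVec m' ψ₁ ψ₂
      = (postCircuit k k hk2 hm').op *ᵥ padZero h φ := by
    rw [Circuit.op_append, ← Matrix.mulVec_mulVec, inputVec_eq_padZero h, Circuit.lift_mulVec]
  obtain ⟨e1, e2⟩ := postCircuit_spec hk2 hm' (φ := padZero h φ)
    fun z hz j hj => padZero_ne_zero hz (hk.trans hj)
  -- The idle wires do not affect the distribution of the output of the old circuit.
  have htrue : weight (padZero h φ) (fun z => z ⟨0, by omega⟩ = true)
      = weight φ (fun z => z ⟨0, h1⟩ = true) :=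
    weight_padZero h φ fun z => z ⟨0, h1⟩ = true
  have hfalse : weight (padZero h φ) (fun z => z ⟨0, by omega⟩ = false)
      = weight φ (fun z => z ⟨0, h1⟩ = false) :=
    weight_padZero h φ fun z => z ⟨0, h1⟩ = false
  have hsum := weight_false_add_weight_true C ⟨0, h1⟩ ψ₁ ψ₂
  rw [eventProb_projOne_mul_projOne, eventProb_projOne, eventProb_projOne, hout, ← hφ, e1, e2,
    htrue, hfalse]
  exact ⟨rfl, by rw [← hsum, hφ]; ring⟩

/-- Every polynomial is bounded on the natural numbers by some `c * (n + 1) ^ j`. -/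
lemma exists_eval_le_mul_pow (p : Polynomial ℝ) :
    ∃ c j : ℕ, ∀ n : ℕ, p.eval (n : ℝ) ≤ ((c * (n + 1) ^ j : ℕ) : ℝ) := by
  induction p using Polynomial.induction_on' with
  | add p q hp hq =>
    obtain ⟨c, j, h⟩ := hp
    obtain ⟨c', j', h'⟩ := hq
    refine ⟨c + c', max j j', fun n => ?_⟩
    rw [Polynomial.eval_add]
    refine (add_le_add (h n) (h' n)).trans ?_
    rw [← Nat.cast_add, Nat.add_mul]
    have hn : 0 < n + 1 := n.succ_pos
    gcongr <;> first | exact le_max_left _ _ | exact le_max_right _ _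
  | monomial j a =>
    refine ⟨⌈a⌉₊, j, fun n => ?_⟩
    rw [Polynomial.eval_monomial]
    push_cast
    have : (0 : ℝ) ≤ n := n.cast_nonneg
    gcongr
    · exact Nat.le_ceil a
    · linarith

/-- On rejection with probability `1 - a ≥ 2⁻ᵏ`, acceptance conditioned on postselection has
probability at most `1 / 2`. -/
lemma post_ratio_le_half {a t : ℝ} (ht : 0 < t) (ha : 0 ≤ a) (h : a ≤ 1 - t) :
    t * a / (1 - a + t * a) ≤ 1 / 2 := by
  rw [div_le_div_iff₀ (by nlinarith) two_pos]
  nlinarith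

end

theorem lemma2 (δ : ℝ) (hδ : 0 < δ) :
    ∃ s : ℚ, 0 ≤ s ∧ s < 1 ∧ (s : ℝ) ≤ 1 / 2 + δ ∧
      ∀ r : Polynomial ℝ, (∀ n : ℕ, 0 ≤ r.eval (n : ℝ)) →
        QMA2 (fun _ => 1) (fun n => 1 - (2 : ℝ) ^ (-(r.eval (n : ℝ)))) ⊆
          postQMA2 (fun _ => 1) (fun _ => (s : ℝ)) := by
  refine ⟨1 / 2, by norm_num, by norm_num, by push_cast; linarith, fun r hr L hL => ?_⟩
  obtain ⟨V, hV, hL⟩ := hL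
  -- The number of coins exceeds both `r` and the number of wires of the given verifier.
  obtain ⟨c, j, hcj⟩ := exists_eval_le_mul_pow
    (r + (2 * V.w + V.m + 2).map (Nat.castRingHom ℝ))
  set k : ℕ → ℕ := fun n => c * (n + 1) ^ j with hk
  have hwires : ∀ n : ℕ, ((2 * V.w + V.m + 2).map (Nat.castRingHom ℝ)).eval (n : ℝ)
      = ((V.wires n + 2 : ℕ) : ℝ) := fun n => by
    rw [Polynomial.eval_natCast_map]
    simp [Verifier.wires]
  have hkw : ∀ n, V.wires n + 2 ≤ k n := fun n => by
    have h1 := hcj n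
    rw [Polynomial.eval_add, hwires] at h1
    have h2 := hr n
    exact_mod_cast (by linarith : ((V.wires n + 2 : ℕ) : ℝ) ≤ (k n : ℕ))
  have hkr : ∀ n : ℕ, r.eval (n : ℝ) ≤ k n := fun n => by
    have h1 := hcj n
    rw [Polynomial.eval_add, hwires] at h1
    have h2 : (0 : ℝ) ≤ ((V.wires n + 2 : ℕ) : ℝ) := Nat.cast_nonneg _
    linarith
  let κ : Polynomial ℕ := .C c * (.X + 1) ^ j
  have hκ : ∀ n, κ.eval n = k n := fun n => by simp [κ, hk]
  let m' : Polynomial ℕ := V.m + 3 * κ + 1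
  have hm' : ∀ n, m'.eval n = V.m.eval n + 3 * k n + 1 := fun n => by simp [m', hκ]
  have h2 : ∀ n, 2 ≤ k n := fun n => by have := hkw n; omega
  have hle : ∀ n, V.wires n ≤ 2 * V.w.eval n + m'.eval n := fun n => by
    rw [hm', Verifier.wires]; omega
  have hlt : ∀ n, k n + 2 * k n < 2 * V.w.eval n + m'.eval n := fun n => by rw [hm']; omega
  let V' : Verifier :=
    { w := V.w
      m := m'
      circuit := fun x => (V.circuit x).lift (hle x.length) ++
        postCircuit (k x.length) (k x.length) (h2 x.length) (hlt x.length)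
      uniform := by
        simp only [Circuit.encode_append, Circuit.encode_lift, encode_postCircuit]
        exact polyTime_append_postCode V.uniform c j }
  have hV' : ∀ n, 2 ≤ V'.wires n := fun n => by
    have := hlt n; have := h2 n; simp only [V', Verifier.wires]; omega
  have hprob : ∀ x ψ₁ ψ₂,
      V'.probOutPost hV' x ψ₁ ψ₂ = (2 ^ k x.length)⁻¹ * V.probOut hV x ψ₁ ψ₂ ∧
      V'.probPost hV' x ψ₁ ψ₂ = 1 - V.probOut hV x ψ₁ ψ₂ +
        (2 ^ k x.length)⁻¹ * V.probOut hV x ψ₁ ψ₂ := fun x ψ₁ ψ₂ =>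
    eventProb_post (V.circuit x) (hV x.length) ((Nat.le_add_right _ 2).trans (hkw x.length)) (h2 x.length)
      (hle x.length) (hlt x.length) ψ₁ ψ₂
  have hnonneg : ∀ x ψ₁ ψ₂, 0 ≤ V.probOut hV x ψ₁ ψ₂ := fun x ψ₁ ψ₂ => by
    rw [Verifier.probOut, Verifier.prob, eventProb_projOne]
    exact weight_nonneg _ _
  have hle_one : ∀ x ψ₁ ψ₂, V.probOut hV x ψ₁ ψ₂ ≤ 1 := fun x ψ₁ ψ₂ => by
    rw [Verifier.probOut, Verifier.prob, eventProb_projOne,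
      ← weight_false_add_weight_true (V.circuit x) ⟨0, hV x.length⟩ ψ₁ ψ₂]
    exact le_add_of_nonneg_left (weight_nonneg _ _)
  refine ⟨V', hV', κ, fun x => ⟨fun ψ₁ ψ₂ => ?_, fun hx => ?_, fun hx ψ₁ ψ₂ => ?_⟩⟩
  · have ht : ((2 : ℝ) ^ k x.length)⁻¹ ≤ 1 := inv_le_one_of_one_le₀ (one_le_pow₀ one_le_two)
    rw [hκ, (hprob x ψ₁ ψ₂).2]
    nlinarith [hle_one x ψ₁ ψ₂]
  · obtain ⟨ψ₁, ψ₂, h⟩ := (hL x).1 hx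
    refine ⟨ψ₁, ψ₂, ?_⟩
    have h1 : V.probOut hV x ψ₁ ψ₂ = 1 := le_antisymm (hle_one x ψ₁ ψ₂) h
    rw [Verifier.probOutGivenPost, (hprob x ψ₁ ψ₂).1, (hprob x ψ₁ ψ₂).2, h1, sub_self, zero_add,
      div_self (by positivity)]
  · have h := (hL x).2 hx ψ₁ ψ₂
    rw [Verifier.probOutGivenPost, (hprob x ψ₁ ψ₂).1, (hprob x ψ₁ ψ₂).2]
    push_cast
    refine post_ratio_le_half (by positivity) (hnonneg x ψ₁ ψ₂) (h.trans ?_)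
    rw [← Real.rpow_natCast, ← Real.rpow_neg zero_le_two]
    have := hkr x.length
    exact sub_le_sub_left (Real.rpow_le_rpow_of_exponent_le one_le_two (neg_le_neg this)) 1
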